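/- Let $k$ be a commutative ring and let $(W,S)$ be a Coxeter system with Coxeter matrix $(m_{s,t})$. Let $B_W$ be its Artin braid group, with generators $g_s$ ($s\in S$) and relations $g_sg_tg_s\cdots=g_tg_sg_t\cdots$ ($m_{s,t}$ factors on each side, whenever $m_{s,t}<\infty$). For $w\in W$ with a reduced expression $w=s_1\cdots s_r$ put $g_w=g_{s_1}\cdots g_{s_r}\in B_W$; this does not depend on the choice of the reduced expression. Let $A$ be a commutative $k$-algebra, $\rho\colon W\to\mathrm{Aut}_{k\text{-alg}}(A)$ an action, and $a\colon S\to A^\times$ a map that is $W$-equivariant, i.e. $\rho_w(a_s)=a_{s'}$ whenever $s,s'\in S$ and $w\in W$ satisfy $wsw^{-1}=s'$. Let $B_W$ act on $A$ through the projection $B_W\to W$ and let $\mathcal E^{(W,S)}(A,\rho,a)$ be the quotient of the semidirect product $A\rtimes k[B_W]$ (in which $gc=(g.c)g$ for $g\in B_W$, $c\in A$) by the two-sided ideal generated by the elements $g_s^2-a_s-(1-a_s)g_s$, $s\in S$. (1) Suppose that $A$ is free of finite rank over $k$ and that $(1-a_s)(1-\rho_s)=0$ in $\mathrm{End}_k(A)$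 for all $s\in S$. Then $\mathcal E^{(W,S)}(A,\rho,a)$ is free over $k$, and for every $k$-basis $(c_i)_{i\in I}$ of $A$ the family $(c_ig_w)_{(i,w)\in I\times W}$ is a $k$-basis of it. If $k\neq0$, then $\mathrm{rk}_k\,\mathcal E^{(W,S)}(A,\rho,a)=|W|\cdot\mathrm{rk}_kA$ (as cardinal numbers). If $W$ is finite, then $\mathcal E^{(W,S)}(A,\rho,a)$ is a finitely generated $k$-module, hence free of finite rank, and for $k\ne 0$ the formula is one of natural numbers. (2) Let $W$ be finite and let $\Phi$ be the root system of $(W,S)$, i.e. the set of all $w.\alpha_s$ ($w\in W$, $s\in S$) in the standard geometric representation, where $\alpha_s$ is the simple root of $s$. A root subsystem is a subset of $\Phi$ that is stable under the reflections in its elements. The set $\Sigma(\Phi)$ of root subsystems is a commutative monoid, the product of two root subsystems being the root subsystem generated by their union, and $W$ acts on it. Let $u\colon S\to k^\times$ satisfy $u_s=u_{s'}$ whenever $s$ and $s'$ are conjugate in $W$, and let $\hat e_s=1+(u_s-1)\{\alpha_s,-\alpha_s\}\in k[\Sigma(\Phi)]^\times$. Let $\mathcal C_W=\mathcal E^{(W,S)}(k[\Sigma(\Phi)],\rho,\hat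 e)$, with $\rho$ the induced action of $W$ on the monoid algebra. Then $\mathcal C_W$ is free of finite rank over $k$ and, if $k\neq0$, its rank is $\mathrm{rk}_k\,\mathcal C_W=\mathrm{Bell}(W)\,|W|$, where $\mathrm{Bell}(W)$ is the number of reflection subgroups of $W$ (subgroups generated by reflections, i.e. by conjugates of elements of $S$). -/

import Mathlib

universe uk uB uW uA uI

noncomputable section

/-! ### Artin braid groups -/

namespace CoxeterMatrix

variable {B : Type*} (M : CoxeterMatrix B)

/-- The braid relations `s_i s_j s_i ⋯ = s_j s_i s_j ⋯` (`M i j` factors on each side), one for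
every pair of generators with `M i j ≠ ∞` (in Mathlib, `∞` is encoded as `0`). -/
def braidRelations : Set (FreeGroup B) :=
  {r | ∃ i j : B, M i j ≠ 0 ∧
    r = ((CoxeterSystem.braidWord M i j).map FreeGroup.of).prod *
      (((CoxeterSystem.braidWord M j i).map FreeGroup.of).prod)⁻¹}

/-- The Artin braid group `B_W` of a Coxeter matrix. -/
abbrev ArtinGroup : Type _ := PresentedGroup M.braidRelations

/-- The standard generator of the Artin braid group. -/
def artinGenerator (i : B) : M.ArtinGroup := PresentedGroup.of i

/-- The bilinear form `(e_i, e_j) ↦ -cos (π / m_ij)` on the real vector space with basis `B`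
(for `m_ij = ∞`, encoded as `0`, its value is `-1`). -/
def geomForm : (B →₀ ℝ) →ₗ[ℝ] (B →₀ ℝ) →ₗ[ℝ] ℝ :=
  Finsupp.linearCombination ℝ fun i =>
    Finsupp.linearCombination ℝ fun j => -Real.cos (Real.pi / (M i j : ℝ))

/-- The simple root attached to a generator. -/
def simpleRoot (_M : CoxeterMatrix B) (i : B) : B →₀ ℝ := Finsupp.single i 1

/-- The map `x ↦ x - 2 (v, x) v`, which is the reflection in `v` if `v` is a unit vector. -/
def reflectionIn (v : B →₀ ℝ) : (B →₀ ℝ) →ₗ[ℝ] (B →₀ ℝ) :=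
  Module.preReflection v ((2 : ℝ) • M.geomForm v)

theorem reflectionIn_apply (v x : B →₀ ℝ) :
    M.reflectionIn v x = x - (2 * M.geomForm v x) • v := by
  simp [reflectionIn, Module.preReflection_apply]

theorem geomForm_simpleRoot (i j : B) :
    M.geomForm (M.simpleRoot i) (M.simpleRoot j) = -Real.cos (Real.pi / (M i j : ℝ)) := by
  simp [geomForm, simpleRoot]

theorem geomForm_simpleRoot_self (i : B) :
    M.geomForm (M.simpleRoot i) (M.simpleRoot i) = 1 := by
  simp [geomForm_simpleRoot]

theorem geomForm_comm (x y : B →₀ ℝ) : M.geomForm x y = M.geomForm y x := by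
  have h : M.geomForm = M.geomForm.flip := by
    ext i j
    have := M.geomForm_simpleRoot i j
    have h2 := M.geomForm_simpleRoot j i
    simp only [simpleRoot] at this h2
    simp [this, h2, M.symmetric i j]
  exact congrArg (fun f => f x y) h

theorem two_smul_geomForm_simpleRoot (i : B) :
    ((2 : ℝ) • M.geomForm (M.simpleRoot i)) (M.simpleRoot i) = 2 := by
  simp [geomForm_simpleRoot_self]

/-- The reflection of the geometric representation attached to a generator. -/
def simpleReflection (i : B) : (B →₀ ℝ) ≃ₗ[ℝ] (B →₀ ℝ) :=
  Module.reflection (M.two_smul_geomForm_simpleRoot i)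

theorem simpleReflection_apply (i : B) (x : B →₀ ℝ) :
    M.simpleReflection i x = M.reflectionIn (M.simpleRoot i) x := rfl

open Polynomial.Chebyshev in
theorem simpleReflection_isLiftable : M.IsLiftable M.simpleReflection := by
  intro i j
  by_cases hij : i = j
  · subst hij
    rw [M.diagonal, pow_one]
    apply LinearEquiv.ext
    intro x
    rw [LinearEquiv.mul_apply]
    exact Module.involutive_reflection (M.two_smul_geomForm_simpleRoot i) x
  have hm1 : M i j ≠ 1 := M.off_diagonal i j hij
  apply LinearEquiv.ext
  intro z
  have hgf : ∀ a b : B, ((2 : ℝ) • M.geomForm (M.simpleRoot a)) (M.simpleRoot b) =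
      -2 * Real.cos (Real.pi / (M a b : ℝ)) := by
    intro a b
    simp [geomForm_simpleRoot]
  rcases Nat.lt_or_ge (M i j) 3 with hlt | hge
  · have h02 : M i j = 0 ∨ M i j = 2 := by omega
    rcases h02 with h0 | h2
    · rw [h0]; rfl
    · have key := Module.reflection_mul_reflection_pow_apply
        (M.two_smul_geomForm_simpleRoot i) (M.two_smul_geomForm_simpleRoot j) 2 z
      rw [h2]
      have e1 := hgf i j
      have e2 := hgf j i
      rw [M.symmetric j i] at e2
      simp only [h2, Nat.cast_ofNat, Real.cos_pi_div_two, mul_zero] at e1 e2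
      simp only [e1, e2] at key
      refine key.trans ?_
      norm_num
      abel
  · set m := M i j with hm
    have hm0 : (m : ℝ) ≠ 0 := by positivity
    set θ : ℝ := 2 * (Real.pi / m) with hθ
    have hsin : Real.sin θ ≠ 0 := by
      apply ne_of_gt
      apply Real.sin_pos_of_pos_of_lt_pi
      · positivity
      · have h3 : (3 : ℝ) ≤ m := by exact_mod_cast hge
        rw [hθ, ← mul_div_assoc, div_lt_iff₀ (by positivity)]
        nlinarith [Real.pi_pos]
    have ht : 2 * Real.cos θ = ((2 : ℝ) • M.geomForm (M.simpleRoot i)) (M.simpleRoot j) *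
        ((2 : ℝ) • M.geomForm (M.simpleRoot j)) (M.simpleRoot i) - 2 := by
      rw [hgf, hgf, M.symmetric j i, hθ, Real.cos_two_mul]
      ring
    have key := Module.reflection_mul_reflection_pow_apply
      (M.two_smul_geomForm_simpleRoot i) (M.two_smul_geomForm_simpleRoot j) m z _ ht
    refine key.trans ?_
    have hS : ∀ n : ℤ, (S ℝ n).eval (2 * Real.cos θ) = Real.sin ((n + 1) * θ) / Real.sin θ := by
      intro n
      rw [eq_div_iff hsin]
      exact S_two_mul_real_cos θ n
    have hmθ : (m : ℝ) * θ = 2 * Real.pi := by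
      rw [hθ]; field_simp
    have hodd : ∀ k : ℤ, (2 * k + 1 : ℝ) * θ = 2 * Real.pi →
        (S ℝ k).eval (2 * Real.cos θ) + (S ℝ (k - 1)).eval (2 * Real.cos θ) = 0 := by
      intro k hk
      rw [hS, hS, ← add_div]
      have : ((k : ℝ) + 1) * θ = 2 * Real.pi - k * θ := by linear_combination hk
      push_cast
      rw [this, Real.sin_two_pi_sub]
      simp
    have heven : ∀ k : ℤ, (2 * k : ℝ) * θ = 2 * Real.pi →
        (S ℝ (k - 1)).eval (2 * Real.cos θ) = 0 := by
      intro k hk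
      rw [hS]
      have : (((k - 1 : ℤ) : ℝ) + 1) * θ = Real.pi := by push_cast; linear_combination hk / 2
      rw [this]
      simp
    rcases Nat.even_or_odd' m with ⟨k, hk | hk⟩
    · have h1 : ((m : ℤ) - 2) / 2 = (k : ℤ) - 1 := by omega
      have h2 : ((m : ℤ) - 1) / 2 = (k : ℤ) - 1 := by omega
      have hz := heven k (by rw [← hmθ, hk]; push_cast; ring)
      rw [h1, h2, hz]
      simp
    · have h1 : ((m : ℤ) - 2) / 2 = (k : ℤ) - 1 := by omega
      have h2 : ((m : ℤ) - 1) / 2 = (k : ℤ) := by omega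
      have h3 : ((m : ℤ) - 3) / 2 = (k : ℤ) - 1 := by omega
      have h4 : (m : ℤ) / 2 = (k : ℤ) := by omega
      have hz := hodd k (by rw [← hmθ, hk]; push_cast; ring)
      rw [h1, h2, h3, h4, hz]
      simp

end CoxeterMatrix

/-! ### The geometric representation, the root system, and reflection subgroups -/

namespace CoxeterSystem

variable {B W : Type*} [Group W] {M : CoxeterMatrix B} (cs : CoxeterSystem M W)

/-- The standard geometric representation of a Coxeter system. -/
def geomRep : W →* ((B →₀ ℝ) ≃ₗ[ℝ] (B →₀ ℝ)) :=
  cs.lift ⟨M.simpleReflection, M.simpleReflection_isLiftable⟩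

theorem geomRep_simple (i : B) : cs.geomRep (cs.simple i) = M.simpleReflection i :=
  cs.lift_apply_simple M.simpleReflection_isLiftable i

/-- The root system `Φ` of a Coxeter system. -/
def roots : Set (B →₀ ℝ) := {α | ∃ (w : W) (i : B), α = cs.geomRep w (M.simpleRoot i)}

/-- The number of reflection subgroups of `W`, that is, of subgroups generated by reflections. -/
def bell : ℕ :=
  Nat.card {H : Subgroup W //
    ∃ T : Set W, (∀ t ∈ T, cs.IsReflection t) ∧ H = Subgroup.closure T}

/-- The projection of the Artin braid group onto the Coxeter group. -/
def artinProj : M.ArtinGroup →* W :=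
  PresentedGroup.toGroup (f := cs.simple) (by
    rintro r ⟨i, j, -, rfl⟩
    have h : ∀ ω : List B, FreeGroup.lift cs.simple ((ω.map FreeGroup.of).prod) =
        cs.wordProd ω := by
      intro ω
      rw [map_list_prod, List.map_map]
      simp [wordProd, Function.comp_def]
    rw [map_mul, map_inv, h, h, cs.wordProd_braidWord_eq i j, mul_inv_cancel])

/-- The canonical set-theoretical section `w ↦ g_w` of `artinProj`: the product of the generators
of the Artin braid group along a reduced expression for `w`. -/
def artinSection (w : W) : M.ArtinGroup :=
  ((cs.exists_isReduced w).choose.map M.artinGenerator).prod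

theorem geomForm_geomRep (w : W) (x y : B →₀ ℝ) :
    M.geomForm (cs.geomRep w x) (cs.geomRep w y) = M.geomForm x y := by
  induction w using cs.simple_induction_left generalizing x y with
  | one => simp
  | mul_simple_left w i ih =>
    rw [map_mul, LinearEquiv.mul_apply, LinearEquiv.mul_apply, geomRep_simple,
      CoxeterMatrix.simpleReflection_apply, CoxeterMatrix.simpleReflection_apply, ← ih x y,
      CoxeterMatrix.reflectionIn_apply, CoxeterMatrix.reflectionIn_apply]
    simp only [map_sub, map_smul, LinearMap.sub_apply, LinearMap.smul_apply, smul_eq_mul,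
      M.geomForm_simpleRoot_self, M.geomForm_comm _ (M.simpleRoot i)]
    ring

theorem geomRep_reflectionIn (w : W) (v x : B →₀ ℝ) :
    cs.geomRep w (M.reflectionIn v x) = M.reflectionIn (cs.geomRep w v) (cs.geomRep w x) := by
  simp only [CoxeterMatrix.reflectionIn_apply, map_sub, map_smul, geomForm_geomRep]

theorem geomForm_root_self {α : B →₀ ℝ} (hα : α ∈ cs.roots) : M.geomForm α α = 1 := by
  obtain ⟨w, i, rfl⟩ := hα
  rw [geomForm_geomRep, M.geomForm_simpleRoot_self]

theorem reflectionIn_root_self {α : B →₀ ℝ} (hα : α ∈ cs.roots) :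
    M.reflectionIn α α = -α := by
  rw [M.reflectionIn_apply, cs.geomForm_root_self hα]
  module

theorem geomRep_mem_roots (w : W) {α : B →₀ ℝ} (hα : α ∈ cs.roots) :
    cs.geomRep w α ∈ cs.roots := by
  obtain ⟨v, i, rfl⟩ := hα
  exact ⟨w * v, i, by rw [map_mul, LinearEquiv.mul_apply]⟩

theorem simpleRoot_mem_roots (i : B) : M.simpleRoot i ∈ cs.roots := ⟨1, i, by simp⟩

theorem reflectionIn_mem_roots {α β : B →₀ ℝ} (hα : α ∈ cs.roots) (hβ : β ∈ cs.roots) :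
    M.reflectionIn α β ∈ cs.roots := by
  obtain ⟨w, i, rfl⟩ := hα
  have h : M.reflectionIn (cs.geomRep w (M.simpleRoot i)) β =
      cs.geomRep (w * cs.simple i * w⁻¹) β := by
    rw [map_mul, map_mul, LinearEquiv.mul_apply, LinearEquiv.mul_apply, geomRep_simple,
      M.simpleReflection_apply, geomRep_reflectionIn, ← LinearEquiv.mul_apply, ← map_mul]
    simp
  rw [h]
  exact cs.geomRep_mem_roots _ hβ

theorem neg_mem_roots {α : B →₀ ℝ} (hα : α ∈ cs.roots) : -α ∈ cs.roots := by
  rw [← cs.reflectionIn_root_self hα]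
  exact cs.reflectionIn_mem_roots hα hα

/-- If `w s_i w⁻¹ = s_j`, then `w` maps the simple root of `i` to plus or minus that of `j`. -/
theorem geomRep_simpleRoot_eq {i j : B} {w : W} (h : w * cs.simple i * w⁻¹ = cs.simple j) :
    cs.geomRep w (M.simpleRoot i) = M.simpleRoot j ∨
      cs.geomRep w (M.simpleRoot i) = -M.simpleRoot j := by
  set α := cs.geomRep w (M.simpleRoot i) with hα
  have hαr : α ∈ cs.roots := cs.geomRep_mem_roots w (cs.simpleRoot_mem_roots i)
  have hj : M.reflectionIn (M.simpleRoot j) α = -α := by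
    rw [← M.simpleReflection_apply, ← cs.geomRep_simple, ← h, map_mul, map_mul,
      LinearEquiv.mul_apply, LinearEquiv.mul_apply, hα,
      ← LinearEquiv.mul_apply (cs.geomRep w⁻¹) (cs.geomRep w), ← map_mul cs.geomRep w⁻¹ w,
      inv_mul_cancel, map_one, LinearEquiv.coe_one, id, geomRep_simple,
      M.simpleReflection_apply, cs.reflectionIn_root_self (cs.simpleRoot_mem_roots i), map_neg]
  rw [M.reflectionIn_apply] at hj
  set c := M.geomForm (M.simpleRoot j) α with hc
  have hαc : α = c • M.simpleRoot j := by
    have h2 : (2 : ℝ) • α = (2 : ℝ) • (c • M.simpleRoot j) := by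
      rw [two_smul, smul_smul]
      nth_rewrite 1 [← neg_neg α]
      rw [← hj]
      abel
    exact smul_right_injective _ (two_ne_zero' ℝ) h2
  have hcc : c * c = 1 := by
    have h1 := cs.geomForm_root_self hαr
    rw [hαc] at h1
    simpa [M.geomForm_simpleRoot_self] using h1
  rcases mul_self_eq_one_iff.mp hcc with h1 | h1
  · left; rw [hαc, h1, one_smul]
  · right; rw [hαc, h1, neg_smul, one_smul]

/-! ### The monoid of root subsystems -/

/-- A root subsystem: a set of roots which is stable under the reflections in its elements. -/
@[ext]
structure RootSubsystem where
  carrier : Set (B →₀ ℝ)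
  subset_roots : carrier ⊆ cs.roots
  reflectionIn_mem : ∀ α ∈ carrier, ∀ β ∈ carrier, M.reflectionIn α β ∈ carrier

namespace RootSubsystem

variable {cs}

/-- The root subsystem generated by a set of roots (roots being all that is kept of the given
set). -/
def generated (X : Set (B →₀ ℝ)) : cs.RootSubsystem where
  carrier := {α | α ∈ cs.roots ∧
    ∀ Ψ : cs.RootSubsystem, X ∩ cs.roots ⊆ Ψ.carrier → α ∈ Ψ.carrier}
  subset_roots := fun _ hα => hα.1
  reflectionIn_mem := fun α hα β hβ =>
    ⟨cs.reflectionIn_mem_roots hα.1 hβ.1,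
      fun Ψ hΨ => Ψ.reflectionIn_mem α (hα.2 Ψ hΨ) β (hβ.2 Ψ hΨ)⟩

/-- The root subsystem `{α, -α}` attached to a simple root `α`. -/
def simple (i : B) : cs.RootSubsystem where
  carrier := {M.simpleRoot i, -M.simpleRoot i}
  subset_roots := by
    rintro α (rfl | rfl)
    · exact cs.simpleRoot_mem_roots i
    · exact cs.neg_mem_roots (cs.simpleRoot_mem_roots i)
  reflectionIn_mem := by
    have h := cs.reflectionIn_root_self (cs.simpleRoot_mem_roots i)
    have h' : ∀ x, M.reflectionIn (-M.simpleRoot i) x = M.reflectionIn (M.simpleRoot i) x := by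
      intro x
      simp [CoxeterMatrix.reflectionIn_apply]
    rintro α (rfl | rfl) β (rfl | rfl) <;> simp [h, h']

theorem generated_carrier_subset {X : Set (B →₀ ℝ)} {Ψ : cs.RootSubsystem}
    (h : X ⊆ Ψ.carrier) : (generated X : cs.RootSubsystem).carrier ⊆ Ψ.carrier :=
  fun _ hα => hα.2 Ψ (fun _ hx => h hx.1)

theorem subset_generated {X : Set (B →₀ ℝ)} (h : X ⊆ cs.roots) :
    X ⊆ (generated X : cs.RootSubsystem).carrier :=
  fun _ hα => ⟨h hα, fun _ hΨ => hΨ ⟨hα, h hα⟩⟩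

theorem le_antisymm' {Ψ Ψ' : cs.RootSubsystem} (h : Ψ.carrier ⊆ Ψ'.carrier)
    (h' : Ψ'.carrier ⊆ Ψ.carrier) : Ψ = Ψ' :=
  RootSubsystem.ext (Set.Subset.antisymm h h')

/-- The product of two root subsystems is the root subsystem generated by them. -/
instance : Mul cs.RootSubsystem := ⟨fun Ψ Ψ' => generated (Ψ.carrier ∪ Ψ'.carrier)⟩

instance : One cs.RootSubsystem := ⟨⟨∅, Set.empty_subset _, fun _ h => h.elim⟩⟩

theorem mul_def (Ψ Ψ' : cs.RootSubsystem) :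
    Ψ * Ψ' = generated (Ψ.carrier ∪ Ψ'.carrier) := rfl

theorem left_subset_mul (Ψ Ψ' : cs.RootSubsystem) : Ψ.carrier ⊆ (Ψ * Ψ').carrier :=
  Set.Subset.trans Set.subset_union_left
    (subset_generated (Set.union_subset Ψ.subset_roots Ψ'.subset_roots))

theorem right_subset_mul (Ψ Ψ' : cs.RootSubsystem) : Ψ'.carrier ⊆ (Ψ * Ψ').carrier :=
  Set.Subset.trans Set.subset_union_right
    (subset_generated (Set.union_subset Ψ.subset_roots Ψ'.subset_roots))

theorem mul_subset {Ψ Ψ' Ω : cs.RootSubsystem} (h : Ψ.carrier ⊆ Ω.carrier)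
    (h' : Ψ'.carrier ⊆ Ω.carrier) : (Ψ * Ψ').carrier ⊆ Ω.carrier :=
  generated_carrier_subset (Set.union_subset h h')

instance : CommMonoid cs.RootSubsystem where
  mul_assoc Ψ₁ Ψ₂ Ψ₃ := le_antisymm'
    (mul_subset
      (mul_subset (left_subset_mul _ _)
        ((left_subset_mul Ψ₂ Ψ₃).trans (right_subset_mul _ _)))
      ((right_subset_mul Ψ₂ Ψ₃).trans (right_subset_mul _ _)))
    (mul_subset ((left_subset_mul Ψ₁ Ψ₂).trans (left_subset_mul _ _))
      (mul_subset ((right_subset_mul Ψ₁ Ψ₂).trans (left_subset_mul _ _))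
        (right_subset_mul _ _)))
  one_mul Ψ := le_antisymm' (mul_subset (Set.empty_subset _) (Set.Subset.refl _))
    (right_subset_mul _ _)
  mul_one Ψ := le_antisymm' (mul_subset (Set.Subset.refl _) (Set.empty_subset _))
    (left_subset_mul _ _)
  mul_comm Ψ Ψ' := le_antisymm' (mul_subset (right_subset_mul _ _) (left_subset_mul _ _))
    (mul_subset (right_subset_mul _ _) (left_subset_mul _ _))

theorem mul_self_eq (Ψ : cs.RootSubsystem) : Ψ * Ψ = Ψ :=
  le_antisymm' (mul_subset (Set.Subset.refl _) (Set.Subset.refl _)) (left_subset_mul _ _)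

/-- The action of `W` on root subsystems induced by the geometric representation. -/
instance : SMul W cs.RootSubsystem where
  smul w Ψ :=
    { carrier := cs.geomRep w '' Ψ.carrier
      subset_roots := by
        rintro _ ⟨α, hα, rfl⟩
        exact cs.geomRep_mem_roots w (Ψ.subset_roots hα)
      reflectionIn_mem := by
        rintro _ ⟨α, hα, rfl⟩ _ ⟨β, hβ, rfl⟩
        rw [← geomRep_reflectionIn]
        exact ⟨_, Ψ.reflectionIn_mem α hα β hβ, rfl⟩ }

theorem smul_carrier (w : W) (Ψ : cs.RootSubsystem) :
    (w • Ψ).carrier = cs.geomRep w '' Ψ.carrier := rfl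

instance : MulAction W cs.RootSubsystem where
  one_smul Ψ := by
    apply RootSubsystem.ext
    simp [smul_carrier]
  mul_smul v w Ψ := by
    apply RootSubsystem.ext
    simp only [smul_carrier, Set.image_image]
    exact Set.image_congr fun x _ => by rw [map_mul, LinearEquiv.mul_apply]

theorem smul_mono (w : W) {Ψ Ψ' : cs.RootSubsystem} (h : Ψ.carrier ⊆ Ψ'.carrier) :
    (w • Ψ).carrier ⊆ (w • Ψ').carrier :=
  Set.image_mono h

instance : MulDistribMulAction W cs.RootSubsystem where
  smul_one w := by
    apply RootSubsystem.ext
    change _ '' (∅ : Set (B →₀ ℝ)) = ∅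
    simp
  smul_mul w Ψ Ψ' := by
    refine le_antisymm' ?_
      (mul_subset (smul_mono w (left_subset_mul _ _)) (smul_mono w (right_subset_mul _ _)))
    have h : (Ψ * Ψ').carrier ⊆ (w⁻¹ • (w • Ψ * w • Ψ')).carrier := by
      apply mul_subset
      · have := smul_mono w⁻¹ (left_subset_mul (w • Ψ) (w • Ψ'))
        rwa [inv_smul_smul] at this
      · have := smul_mono w⁻¹ (right_subset_mul (w • Ψ) (w • Ψ'))
        rwa [inv_smul_smul] at this
    have := smul_mono w h
    rwa [smul_inv_smul] at this

theorem smul_simple {i j : B} {w : W} (h : w * cs.simple i * w⁻¹ = cs.simple j) :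
    w • (simple i : cs.RootSubsystem) = simple j := by
  apply RootSubsystem.ext
  rw [smul_carrier]
  change _ '' {M.simpleRoot i, -M.simpleRoot i} = {M.simpleRoot j, -M.simpleRoot j}
  rw [Set.image_pair, map_neg]
  rcases cs.geomRep_simpleRoot_eq h with h | h
  · rw [h]
  · rw [h, neg_neg, Set.pair_comm]

end RootSubsystem

end CoxeterSystem

/-! ### Marin data and Marin algebras -/

/-- A Marin datum `((W,S),A,ρ,a)` over `k`: an action `ρ` of `W` on the commutative `k`-algebra `A`
by `k`-algebra automorphisms and a map `a` from the simple reflections to the units of `A`, which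
is equivariant: if `w s w⁻¹ = s'` for simple reflections `s`, `s'`, then `w.a_s = a_s'`. -/
structure MarinDatum (k : Type*) [CommRing k] {B W : Type*} [Group W] {M : CoxeterMatrix B}
    (cs : CoxeterSystem M W) (A : Type*) [CommRing A] [Algebra k A] where
  ρ : W →* (A ≃ₐ[k] A)
  a : B → Aˣ
  equivariant : ∀ (i j : B) (w : W), w * cs.simple i * w⁻¹ = cs.simple j →
    ρ w (a i : A) = (a j : A)

namespace MarinDatum

variable {k : Type*} [CommRing k] {B W : Type*} [Group W] {M : CoxeterMatrix B}
  {cs : CoxeterSystem M W} {A : Type*} [CommRing A] [Algebra k A] (D : MarinDatum k cs A)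

/-- The Artin braid group of `W`, as a type that carries the action on `A` given by the datum. -/
def BraidGroup (_D : MarinDatum k cs A) : Type _ := M.ArtinGroup

instance : Group D.BraidGroup := inferInstanceAs (Group M.ArtinGroup)

/-- The identity map from the Artin braid group to its copy carrying the action. -/
def toBraidGroup : M.ArtinGroup ≃* D.BraidGroup := MulEquiv.refl M.ArtinGroup

/-- The braid group acts on `A` through its projection to `W`. -/
instance : MulSemiringAction D.BraidGroup A :=
  MulSemiringAction.compHom A
    ((D.ρ.comp cs.artinProj).comp D.toBraidGroup.symm.toMonoidHom : D.BraidGroup →* (A ≃ₐ[k] A))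

theorem braidGroup_smul_def (g : D.BraidGroup) (c : A) :
    g • c = D.ρ (cs.artinProj (D.toBraidGroup.symm g)) c := rfl

instance : SMulCommClass D.BraidGroup k A where
  smul_comm g r c := by simp only [braidGroup_smul_def, map_smul]

/-- The semidirect product `A ⋊ k[B_W]`: the free left `A`-module on `B_W`, with multiplication
`(c g) (c' g') = c (g.c') g g'`. -/
abbrev SemidirectProduct : Type _ := SkewMonoidAlgebra A D.BraidGroup

/-- The inclusion of `A` in `A ⋊ k[B_W]`. -/
def inclA (c : A) : D.SemidirectProduct := SkewMonoidAlgebra.single (1 : D.BraidGroup) c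

/-- The inclusion of `B_W` in `A ⋊ k[B_W]`. -/
def inclB (g : M.ArtinGroup) : D.SemidirectProduct :=
  SkewMonoidAlgebra.single (D.toBraidGroup g) (1 : A)

/-- The relations `g_s ^ 2 = a_s + (1 - a_s) g_s`. -/
inductive Rel : D.SemidirectProduct → D.SemidirectProduct → Prop
  | quadratic (i : B) : Rel (D.inclB (M.artinGenerator i) ^ 2)
      (D.inclA (D.a i) + D.inclA (1 - D.a i) * D.inclB (M.artinGenerator i))

/-- The Marin algebra: the quotient of `A ⋊ k[B_W]` by the two-sided ideal generated by the
elements `g_s ^ 2 - a_s - (1 - a_s) g_s`. -/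
def Alg : Type _ := RingQuot D.Rel

instance : Ring D.Alg := inferInstanceAs (Ring (RingQuot D.Rel))

instance : Algebra k D.Alg := inferInstanceAs (Algebra k (RingQuot D.Rel))

/-- The quotient map `A ⋊ k[B_W] → 𝓔`. -/
def proj : D.SemidirectProduct →ₐ[k] D.Alg := RingQuot.mkAlgHom k D.Rel

/-- The image of an element of `A` in the Marin algebra. -/
def coeff (c : A) : D.Alg := D.proj (D.inclA c)

/-- The element `g_w` of the Marin algebra. -/
def g (w : W) : D.Alg := D.proj (D.inclB (cs.artinSection w))

/-- The Marin datum on the monoid algebra `k[E]` attached to an action of `W` on a commutative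
monoid `E`, an equivariant family `e` of idempotents of `E`, and an equivariant family `u` of units
of `k` (with trivial action); the units are `1 + (u_s - 1) e_s`. -/
def ofMonoid (cs : CoxeterSystem M W) (E : Type*) [CommMonoid E] [MulDistribMulAction W E]
    (e : B → E) (he : ∀ i, e i * e i = e i)
    (he' : ∀ (i j : B) (w : W), w * cs.simple i * w⁻¹ = cs.simple j → w • e i = e j)
    (u : B → kˣ)
    (hu : ∀ (i j : B) (w : W), w * cs.simple i * w⁻¹ = cs.simple j → u i = u j) :
    MarinDatum k cs (MonoidAlgebra k E) where
  ρ := MonoidAlgebra.domCongrAut.comp (MulDistribMulAction.toMulAut W E)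
  a := fun i =>
    { val := 1 + MonoidAlgebra.single (e i) ((u i : k) - 1)
      inv := 1 + MonoidAlgebra.single (e i) (((u i)⁻¹ : kˣ) - 1 : k)
      val_inv := by
        rw [add_mul, one_mul, mul_add, mul_one, MonoidAlgebra.single_mul_single, he, add_assoc, ← MonoidAlgebra.single_add, ← MonoidAlgebra.single_add]
        have : ((((u i)⁻¹ : kˣ) : k) - 1 + (((u i : k) - 1) +
          ((u i : k) - 1) * ((((u i)⁻¹ : kˣ) : k) - 1))) = 0 := by
          linear_combination (u i).mul_inv
        rw [this]
        simp
      inv_val := by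
        rw [add_mul, one_mul, mul_add, mul_one, MonoidAlgebra.single_mul_single, he, add_assoc, ← MonoidAlgebra.single_add, ← MonoidAlgebra.single_add]
        have : ((u i : k) - 1 + (((((u i)⁻¹ : kˣ) : k) - 1) +
          ((((u i)⁻¹ : kˣ) : k) - 1) * ((u i : k) - 1))) = 0 := by
          linear_combination (u i).mul_inv
        rw [this]
        simp }
  equivariant := by
    intro i j w h
    simp [he' i j w h, hu i j w h]

end MarinDatum

/-- The Marin datum that defines Marin's algebra `𝒞_W` over `k`, with parameters `u_s`: it is given
by the action of `W` on the monoid of root subsystems of its root system and by `s ↦ {α_s, -α_s}`. -/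
def CoxeterSystem.marinDatum {k : Type*} [CommRing k] {B W : Type*} [Group W]
    {M : CoxeterMatrix B} (cs : CoxeterSystem M W) (u : B → kˣ)
    (hu : ∀ (i j : B) (w : W), w * cs.simple i * w⁻¹ = cs.simple j → u i = u j) :
    MarinDatum k cs (MonoidAlgebra k cs.RootSubsystem) :=
  MarinDatum.ofMonoid cs cs.RootSubsystem CoxeterSystem.RootSubsystem.simple
    (fun _ => CoxeterSystem.RootSubsystem.mul_self_eq _)
    (fun _ _ _ h => CoxeterSystem.RootSubsystem.smul_simple h) u hu

end

/-!
A root of a Coxeter system is either nonnegative or nonpositive in the basis of simple roots, and a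
simple reflection makes only its own root negative. Applied to `w α_t`, this gives the dichotomy
that drives everything: if `s w ≠ w t`, then `s` is a left descent of `w t` exactly if it is one of
`w`, and if `s w = w t`, then `w a_t = a_s`.

The products `g_s g_w = p g_{sw} + (1 - p) g_w` (with `p = 1` or `p = a_s`) show that the `c g_w`
span the Marin algebra. For independence one lets `g_s` act on the free `A`-module with basis `W` by
these formulas. The analogous right operators, with the same formulas for `g_w g_s`, commute with
the left ones by the dichotomy and the hypothesis `(1 - a_s) (1 - ρ_s) = 0`. An operator commuting
with the right ones is determined by its value at the basis vector of `1`, and Matsumoto's theorem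
thus gives the braid relations of the left operators.

For the root subsystems it remains to see that the reflection subgroup of a root subsystem `Ψ`
contains no reflection in a root outside `Ψ`. On this subgroup the parity of the number of positive
elements of `Ψ` made negative is a character with value `-1` on the reflections in elements of `Ψ`,
so it agrees with the parity of the length. But a reflection `t` in a root outside `Ψ` that
stabilises `Ψ` makes an even number of positive elements `γ` of `Ψ` negative, as they come in pairs
`γ`, `-t γ`.
-/

noncomputable section

namespace CoxeterGroup

open CoxeterSystem

variable {B W : Type*} [Group W] {M : CoxeterMatrix B}

/-! ### Positivity of roots -/

/-- The coefficients `sin (n π / m) / sin (π / m)` of the roots of a dihedral group of order `2 m`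
with respect to its simple roots. Their expression in terms of Chebyshev polynomials also gives the
right value `n` for `m = ∞`, encoded as `0`. -/
def dihedralCoeff (m n : ℕ) : ℝ :=
  (Polynomial.Chebyshev.S ℝ ((n : ℤ) - 1)).eval (2 * Real.cos (Real.pi / m))

theorem dihedralCoeff_zero (m : ℕ) : dihedralCoeff m 0 = 0 := by
  simp [dihedralCoeff]

theorem dihedralCoeff_one (m : ℕ) : dihedralCoeff m 1 = 1 := by
  simp [dihedralCoeff]

theorem dihedralCoeff_add_two (m n : ℕ) :
    dihedralCoeff m (n + 2) =
      2 * Real.cos (Real.pi / m) * dihedralCoeff m (n + 1) - dihedralCoeff m n := by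
  have h := Polynomial.Chebyshev.S_add_two ℝ ((n : ℤ) - 1)
  simp only [dihedralCoeff, Nat.cast_add, Nat.cast_one, Nat.cast_ofNat]
  rw [show (n : ℤ) + 2 - 1 = n - 1 + 2 by ring, h, show (n : ℤ) + 1 - 1 = n - 1 + 1 by ring]
  simp

theorem dihedralCoeff_nonneg {m n : ℕ} (hm : m ≠ 1) (hn : m = 0 ∨ n ≤ m) :
    0 ≤ dihedralCoeff m n := by
  rcases eq_or_ne m 0 with rfl | hm0
  · simp [dihedralCoeff]
  have hm2 : (2 : ℝ) ≤ m := by exact_mod_cast (by omega : 2 ≤ m)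
  have hnm : (n : ℝ) ≤ m := by exact_mod_cast hn.resolve_left hm0
  have hθ : 0 < Real.pi / m := by positivity
  have hmθ : m * (Real.pi / m) = Real.pi := by field_simp
  have hsin : 0 < Real.sin (Real.pi / m) :=
    Real.sin_pos_of_pos_of_lt_pi hθ (by nlinarith)
  have hS : dihedralCoeff m n * Real.sin (Real.pi / m) = Real.sin (n * (Real.pi / m)) := by
    rw [dihedralCoeff, Polynomial.Chebyshev.S_two_mul_real_cos]
    simp
  refine nonneg_of_mul_nonneg_left (hS ▸ ?_) hsin
  exact Real.sin_nonneg_of_nonneg_of_le_pi (by positivity) (by nlinarith)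

theorem simpleRoot_nonneg (i : B) : 0 ≤ M.simpleRoot i :=
  Finsupp.single_nonneg.mpr zero_le_one

theorem simpleRoot_ne_zero (i : B) : M.simpleRoot i ≠ 0 :=
  Finsupp.single_ne_zero.mpr one_ne_zero

variable (cs : CoxeterSystem M W)

theorem geomRep_mul_apply (v w : W) (x : B →₀ ℝ) :
    cs.geomRep (v * w) x = cs.geomRep v (cs.geomRep w x) := by
  rw [map_mul, LinearEquiv.mul_apply]

theorem geomRep_simple_apply (i : B) (x : B →₀ ℝ) :
    cs.geomRep (cs.simple i) x = x - (2 * M.geomForm (M.simpleRoot i) x) • M.simpleRoot i := by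
  rw [geomRep_simple, M.simpleReflection_apply, M.reflectionIn_apply]

theorem geomRep_simple_simpleRoot_self (i : B) :
    cs.geomRep (cs.simple i) (M.simpleRoot i) = -M.simpleRoot i := by
  rw [geomRep_simple, M.simpleReflection_apply,
    cs.reflectionIn_root_self (cs.simpleRoot_mem_roots i)]

theorem geomRep_alternatingWord (s t : B) (n : ℕ) :
    cs.geomRep (cs.wordProd (alternatingWord s t n)) (M.simpleRoot s) =
      if Even n then dihedralCoeff (M s t) (n + 1) • M.simpleRoot s +
        dihedralCoeff (M s t) n • M.simpleRoot t
      else dihedralCoeff (M s t) n • M.simpleRoot s +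
        dihedralCoeff (M s t) (n + 1) • M.simpleRoot t := by
  induction n with
  | zero => simp [alternatingWord, dihedralCoeff_zero, dihedralCoeff_one]
  | succ n ih =>
    rw [alternatingWord_succ', wordProd_cons, geomRep_mul_apply, ih]
    by_cases hn : Even n <;>
    · simp only [hn, Nat.even_add_one, not_true, not_false_eq_true, if_true, if_false,
        geomRep_simple_apply, map_add, map_smul, M.geomForm_simpleRoot, M.diagonal, M.symmetric t s,
        Nat.cast_one, div_one, Real.cos_pi, dihedralCoeff_add_two]
      module

variable {cs}

theorem geomRep_mul_alternatingWord_nonneg {s t : B} (hst : s ≠ t) {v : W} {n : ℕ}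
    (hn : M s t = 0 ∨ n + 1 ≤ M s t) (hs : 0 ≤ cs.geomRep v (M.simpleRoot s))
    (ht : 0 ≤ cs.geomRep v (M.simpleRoot t)) :
    0 ≤ cs.geomRep (v * cs.wordProd (alternatingWord s t n)) (M.simpleRoot s) := by
  have hM : M s t ≠ 1 := M.off_diagonal s t hst
  have hc : 0 ≤ dihedralCoeff (M s t) n := dihedralCoeff_nonneg hM (by omega)
  have hc' : 0 ≤ dihedralCoeff (M s t) (n + 1) := dihedralCoeff_nonneg hM hn
  rw [geomRep_mul_apply, geomRep_alternatingWord]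
  split_ifs <;> rw [map_add, map_smul, map_smul] <;>
    exact add_nonneg (smul_nonneg ‹_› hs) (smul_nonneg ‹_› ht)

theorem exists_eq_mul_wordProd_alternatingWord {w : W} {s : B} (hs : ¬ cs.IsRightDescent w s)
    (t : B) :
    ∃ (v : W) (n : ℕ), ¬ cs.IsRightDescent v s ∧ ¬ cs.IsRightDescent v t ∧
      w = v * cs.wordProd (alternatingWord s t n) ∧ cs.length v + n = cs.length w := by
  induction hl : cs.length w using Nat.strong_induction_on generalizing w s t with
  | _ l ih =>
    by_cases ht : cs.IsRightDescent w t
    · obtain ⟨v, n, hvt, hvs, hw, hlv⟩ := ih _ (hl ▸ ht)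
        (cs.isRightDescent_iff_not_isRightDescent_mul.mp ht) s rfl
      refine ⟨v, n + 1, hvs, hvt, ?_, by have := cs.isRightDescent_iff.mp ht; omega⟩
      rw [alternatingWord_succ, wordProd_concat, ← mul_assoc, ← hw, simple_mul_simple_cancel_right]
    · exact ⟨w, 0, hs, ht, by simp [alternatingWord], hl⟩

theorem wordProd_alternatingWord_lt_length {s t : B} (hM : M s t ≠ 0) {n : ℕ} (hn : M s t < n) :
    cs.length (cs.wordProd (alternatingWord s t n)) < n := by
  have hle := cs.length_wordProd_le (alternatingWord s t n)
  have hne := cs.not_isReduced_alternatingWord s t hM hn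
  rw [CoxeterSystem.IsReduced] at hne
  rw [length_alternatingWord] at hle hne
  omega

theorem geomRep_nonneg {w : W} {s : B} (hs : ¬ cs.IsRightDescent w s) :
    0 ≤ cs.geomRep w (M.simpleRoot s) := by
  induction hl : cs.length w using Nat.strong_induction_on generalizing w s with
  | _ l ih =>
    obtain rfl | hw := eq_or_ne w 1
    · simpa using simpleRoot_nonneg s
    obtain ⟨t, ht⟩ := cs.exists_rightDescent_of_ne_one hw
    have hst : s ≠ t := fun h => hs (h ▸ ht)
    obtain ⟨v, n, hvs, hvt, rfl, hlv⟩ := exists_eq_mul_wordProd_alternatingWord hs t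
    have hn : n ≠ 0 := by
      rintro rfl
      exact hvt (by simpa [alternatingWord] using ht)
    refine geomRep_mul_alternatingWord_nonneg hst ?_ (ih _ (by omega) hvs rfl)
      (ih _ (by omega) hvt rfl)
    by_contra! hM
    have hshort := wordProd_alternatingWord_lt_length (cs := cs) (s := t) (t := s) (n := n + 1)
      (by rw [M.symmetric]; exact hM.1) (by rw [M.symmetric]; exact hM.2)
    have hle := cs.length_mul_le v (cs.wordProd (alternatingWord t s (n + 1)))
    rw [alternatingWord_succ, wordProd_concat] at hle hshort
    rw [cs.not_isRightDescent_iff, mul_assoc] at hs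
    omega

theorem geomRep_nonpos {w : W} {s : B} (hs : cs.IsRightDescent w s) :
    cs.geomRep w (M.simpleRoot s) ≤ 0 := by
  have h := geomRep_nonneg (cs.isRightDescent_iff_not_isRightDescent_mul.mp hs)
  rwa [geomRep_mul_apply, geomRep_simple_simpleRoot_self, map_neg, neg_nonneg] at h

theorem not_isRightDescent_iff_nonneg {w : W} {s : B} :
    ¬ cs.IsRightDescent w s ↔ 0 ≤ cs.geomRep w (M.simpleRoot s) := by
  refine ⟨geomRep_nonneg, fun h hs => simpleRoot_ne_zero (M := M) s ?_⟩
  exact (LinearEquiv.map_eq_zero_iff _).mp (le_antisymm (geomRep_nonpos hs) h)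

variable (cs) in
theorem geomRep_injective : Function.Injective cs.geomRep := by
  rw [injective_iff_map_eq_one]
  intro w hw
  by_contra hne
  obtain ⟨s, hs⟩ := cs.exists_rightDescent_of_ne_one hne
  refine not_isRightDescent_iff_nonneg.mpr ?_ hs
  simpa [hw] using simpleRoot_nonneg s

theorem geomRep_conj_simple (w : W) (i : B) (x : B →₀ ℝ) :
    cs.geomRep (w * cs.simple i * w⁻¹) x =
      M.reflectionIn (cs.geomRep w (M.simpleRoot i)) x := by
  rw [geomRep_mul_apply, geomRep_mul_apply, geomRep_simple, M.simpleReflection_apply,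
    geomRep_reflectionIn, ← geomRep_mul_apply]
  simp

theorem eq_simpleRoot_of_nonneg_of_nonpos {α : B →₀ ℝ} (hα : α ∈ cs.roots) {i : B}
    (h : 0 ≤ α) (h' : cs.geomRep (cs.simple i) α ≤ 0) : α = M.simpleRoot i := by
  classical
  have hz : ∀ x, x ≠ i → α x = 0 := fun x hx => by
    refine le_antisymm ?_ (h x)
    simpa [geomRep_simple_apply, CoxeterMatrix.simpleRoot, hx.symm] using h' x
  have hαi : α = α i • M.simpleRoot i := by
    ext x
    by_cases hx : x = i
    · simp [hx, CoxeterMatrix.simpleRoot]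
    · simp [CoxeterMatrix.simpleRoot, Ne.symm hx, hz x hx]
  have hsq : α i * α i = 1 := by
    have := cs.geomForm_root_self hα
    rw [hαi] at this
    simpa [M.geomForm_simpleRoot_self] using this
  have h1 : α i = 1 := by
    have : 0 ≤ α i := h i
    nlinarith
  rw [hαi, h1, one_smul]

theorem simple_mul_eq_mul_simple {w : W} {i j : B} (hw : ¬ cs.IsRightDescent w j)
    (hiw : cs.IsRightDescent (cs.simple i * w) j) : cs.simple i * w = w * cs.simple j := by
  have hroot : cs.geomRep w (M.simpleRoot j) = M.simpleRoot i :=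
    eq_simpleRoot_of_nonneg_of_nonpos (cs.geomRep_mem_roots w (cs.simpleRoot_mem_roots j))
      (geomRep_nonneg hw) (geomRep_mul_apply cs _ _ _ ▸ geomRep_nonpos hiw)
  have hconj : w * cs.simple j * w⁻¹ = cs.simple i := by
    refine geomRep_injective cs (LinearEquiv.ext fun x => ?_)
    rw [geomRep_conj_simple, hroot, geomRep_simple, M.simpleReflection_apply]
  rw [← hconj, inv_mul_cancel_right]

theorem isRightDescent_simple_mul_iff {w : W} {i j : B}
    (h : cs.simple i * w ≠ w * cs.simple j) :
    cs.IsRightDescent (cs.simple i * w) j ↔ cs.IsRightDescent w j := by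
  by_contra hne
  by_cases hw : cs.IsRightDescent w j
  · have hiw : ¬ cs.IsRightDescent (cs.simple i * w) j := fun hiw => hne (by simp [hiw, hw])
    have := simple_mul_eq_mul_simple (i := i) hiw (by simpa using hw)
    rw [simple_mul_simple_cancel_left, mul_assoc] at this
    exact h (by nth_rw 2 [this]; simp [mul_assoc])
  · exact h (simple_mul_eq_mul_simple hw (by_contra fun hiw => hne (by simp [hiw, hw])))

theorem isLeftDescent_mul_simple_iff {w : W} {i j : B}
    (h : cs.simple i * w ≠ w * cs.simple j) :
    cs.IsLeftDescent (w * cs.simple j) i ↔ cs.IsLeftDescent w i := by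
  rw [← isRightDescent_inv_iff, ← isRightDescent_inv_iff, mul_inv_rev, inv_simple]
  refine isRightDescent_simple_mul_iff fun hinv => h ?_
  simpa using (congrArg (·⁻¹) hinv).symm

/-! ### Matsumoto's theorem -/

theorem exists_eq_mul_wordProd_braidWord {w : W} {s t : B} (hst : s ≠ t)
    (hs : cs.IsRightDescent w s) (ht : cs.IsRightDescent w t) :
    M s t ≠ 0 ∧ ∃ v : W, w = v * cs.wordProd (braidWord M s t) ∧
      cs.length v + M s t = cs.length w := by
  obtain ⟨v, n, hvt, hvs, hw, hlv⟩ := exists_eq_mul_wordProd_alternatingWord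
    (cs.isRightDescent_iff_not_isRightDescent_mul.mp ht) s
  have hw' : w = v * cs.wordProd (alternatingWord s t (n + 1)) := by
    rw [alternatingWord_succ, wordProd_concat, ← mul_assoc, ← hw, simple_mul_simple_cancel_right]
  have hlw : cs.length v + (n + 1) = cs.length w := by
    have := cs.isRightDescent_iff.mp ht
    omega
  have hlong : ¬ (M s t = 0 ∨ n + 1 + 1 ≤ M s t) := fun hM => by
    refine not_isRightDescent_iff_nonneg.mpr ?_ hs
    rw [hw']
    exact geomRep_mul_alternatingWord_nonneg hst hM (geomRep_nonneg hvs) (geomRep_nonneg hvt)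
  have hshort : n + 1 ≤ M s t := by
    by_contra! hn
    have hlt := wordProd_alternatingWord_lt_length (cs := cs) (by omega) hn
    have hle := cs.length_mul_le v (cs.wordProd (alternatingWord s t (n + 1)))
    rw [← hw'] at hle
    omega
  have hM : M s t = n + 1 := by omega
  exact ⟨by omega, v, by rw [braidWord, hM, hw'], by rw [hM, hlw]⟩

theorem isReduced_concat_iff {ω : List B} {i : B} :
    cs.IsReduced (ω.concat i) ↔ cs.IsReduced ω ∧ ¬ cs.IsRightDescent (cs.wordProd ω) i := by
  have hle := cs.length_wordProd_le ω
  have hmul := cs.length_mul_simple (cs.wordProd ω) i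
  simp only [CoxeterSystem.IsReduced, not_isRightDescent_iff, wordProd_concat, List.length_concat]
  omega

theorem isRightDescent_of_isReduced_concat {ω : List B} {i : B}
    (h : cs.IsReduced (ω.concat i)) : cs.IsRightDescent (cs.wordProd (ω.concat i)) i := by
  rw [isRightDescent_iff_not_isRightDescent_mul, wordProd_concat, simple_mul_simple_cancel_right]
  exact (isReduced_concat_iff.mp h).2

theorem exists_isReduced_append_braidWord {w : W} {s t : B} (hst : s ≠ t)
    (hs : cs.IsRightDescent w s) (ht : cs.IsRightDescent w t) :
    M s t ≠ 0 ∧ ∃ μ : List B,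
      (cs.IsReduced (μ ++ braidWord M s t) ∧ cs.wordProd (μ ++ braidWord M s t) = w) ∧
      (cs.IsReduced (μ ++ braidWord M t s) ∧ cs.wordProd (μ ++ braidWord M t s) = w) := by
  obtain ⟨hM, v, rfl, hlv⟩ := exists_eq_mul_wordProd_braidWord hst hs ht
  obtain ⟨μ, hμ, rfl⟩ := cs.exists_isReduced v
  rw [hμ.eq] at hlv
  have hst_prod := cs.wordProd_append μ (braidWord M s t)
  have hts_prod : cs.wordProd (μ ++ braidWord M t s) =
      cs.wordProd μ * cs.wordProd (braidWord M s t) := by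
    rw [wordProd_append, wordProd_braidWord_eq]
  refine ⟨hM, μ, ⟨?_, hst_prod⟩, ?_, hts_prod⟩
  · rw [CoxeterSystem.IsReduced, hst_prod, ← hlv, List.length_append, length_alternatingWord]
  · rw [CoxeterSystem.IsReduced, hts_prod, ← hlv, List.length_append, length_alternatingWord,
      M.symmetric t s]

theorem braidWord_eq_concat {s t : B} (hM : M s t ≠ 0) :
    braidWord M s t = (alternatingWord t s (M s t - 1)).concat t := by
  rw [← alternatingWord_succ, Nat.sub_add_cancel (Nat.one_le_iff_ne_zero.mpr hM)]

theorem prod_map_eq_of_isReduced {N : Type*} [Monoid N] {f : B → N}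
    (hf : ∀ s t, M s t ≠ 0 →
      ((braidWord M s t).map f).prod = ((braidWord M t s).map f).prod)
    {ω ω' : List B} (hω : cs.IsReduced ω) (hω' : cs.IsReduced ω')
    (heq : cs.wordProd ω = cs.wordProd ω') : (ω.map f).prod = (ω'.map f).prod := by
  induction hl : ω.length generalizing ω ω' with
  | zero =>
    have hl' : ω'.length = 0 := by rw [← hω'.eq, ← heq, hω.eq, hl]
    rw [List.length_eq_zero_iff.mp hl, List.length_eq_zero_iff.mp hl']
  | succ n ih =>
    have hl' : ω'.length = n + 1 := by rw [← hω'.eq, ← heq, hω.eq, hl]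
    have same_last : ∀ {ν ν' : List B} {i : B}, cs.IsReduced (ν.concat i) →
        cs.IsReduced (ν'.concat i) → cs.wordProd (ν.concat i) = cs.wordProd (ν'.concat i) →
        ν.length = n → ((ν.concat i).map f).prod = ((ν'.concat i).map f).prod := by
      intro ν ν' i hν hν' h hlν
      rw [wordProd_concat, wordProd_concat, mul_left_inj] at h
      have := ih (isReduced_concat_iff.mp hν).1 (isReduced_concat_iff.mp hν').1 h hlν
      simp only [List.concat_eq_append, List.map_append, List.prod_append, this]
    obtain rfl | ⟨ν, s, rfl⟩ := List.eq_nil_or_concat ω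
    · simp at hl
    obtain rfl | ⟨ν', t, rfl⟩ := List.eq_nil_or_concat ω'
    · simp at hl'
    have hlν : ν.length = n := by simpa using hl
    have hlν' : ν'.length = n := by simpa using hl'
    obtain rfl | hst := eq_or_ne s t
    · exact same_last hω hω' heq hlν
    obtain ⟨hM, μ, ⟨hμst, heq_st⟩, hμts, heq_ts⟩ := exists_isReduced_append_braidWord hst
      (isRightDescent_of_isReduced_concat hω) (heq ▸ isRightDescent_of_isReduced_concat hω')
    calc ((ν.concat s).map f).prod
        = ((μ ++ braidWord M t s).map f).prod := by
          rw [braidWord_eq_concat (M.symmetric s t ▸ hM), List.append_concat] at hμts heq_ts ⊢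
          exact same_last hω hμts heq_ts.symm hlν
      _ = ((μ ++ braidWord M s t).map f).prod := by
          rw [List.map_append, List.map_append, List.prod_append, List.prod_append, hf s t hM]
      _ = ((ν'.concat t).map f).prod := by
          rw [braidWord_eq_concat hM, List.append_concat] at hμst heq_st ⊢
          exact (same_last hω' hμst (heq.symm.trans heq_st.symm) hlν').symm

theorem isReduced_alternatingWord {s t : B} (hst : s ≠ t) {n : ℕ}
    (hn : M s t = 0 ∨ n ≤ M s t) : cs.IsReduced (alternatingWord s t n) := by
  induction n generalizing s t with
  | zero => simp [CoxeterSystem.IsReduced, alternatingWord]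
  | succ n ih =>
    rw [M.symmetric s t] at hn
    rw [alternatingWord_succ, isReduced_concat_iff, not_isRightDescent_iff_nonneg]
    refine ⟨ih hst.symm (by omega), ?_⟩
    simpa using geomRep_mul_alternatingWord_nonneg (cs := cs) (v := 1) hst.symm hn
      (by simpa using simpleRoot_nonneg t) (by simpa using simpleRoot_nonneg s)

theorem artinGenerator_braid {i j : B} (h : M i j ≠ 0) :
    ((braidWord M i j).map M.artinGenerator).prod =
      ((braidWord M j i).map M.artinGenerator).prod := by
  have hmk : ∀ ω : List B, (ω.map M.artinGenerator).prod =
      PresentedGroup.mk M.braidRelations (ω.map FreeGroup.of).prod := fun ω => by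
    rw [map_list_prod, List.map_map]
    rfl
  rw [hmk, hmk]
  exact PresentedGroup.mk_eq_mk_of_mul_inv_mem ⟨i, j, h, rfl⟩

theorem artinSection_wordProd {ω : List B} (hω : cs.IsReduced ω) :
    cs.artinSection (cs.wordProd ω) = (ω.map M.artinGenerator).prod :=
  have hchoose := (cs.exists_isReduced (cs.wordProd ω)).choose_spec
  prod_map_eq_of_isReduced (fun _ _ => artinGenerator_braid) hchoose.1 hω hchoose.2.symm

variable (cs) in
@[elab_as_elim]
theorem ascent_induction_right {P : W → Prop} (w : W) (one : P 1)
    (mul_simple : ∀ v i, ¬ cs.IsRightDescent v i → P v → P (v * cs.simple i)) : P w := by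
  obtain ⟨ω, hω, rfl⟩ := cs.exists_isReduced w
  induction ω using List.reverseRecOn with
  | nil => simpa using one
  | append_singleton ω i ih =>
    rw [← List.concat_eq_append] at hω ⊢
    obtain ⟨hω, hi⟩ := isReduced_concat_iff.mp hω
    exact cs.wordProd_concat i ω ▸ mul_simple _ i hi (ih hω)

variable (cs) in
@[elab_as_elim]
theorem ascent_induction_left {P : W → Prop} (w : W) (one : P 1)
    (simple_mul : ∀ v i, ¬ cs.IsLeftDescent v i → P v → P (cs.simple i * v)) : P w := by
  rw [← inv_inv w]
  refine ascent_induction_right cs (P := fun v => P v⁻¹) w⁻¹ (by simpa using one)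
    fun v i hi hv => ?_
  rw [mul_inv_rev, inv_simple]
  exact simple_mul _ i (by rwa [isLeftDescent_inv_iff]) hv

variable (cs) in
theorem artinSection_one : cs.artinSection 1 = 1 := by
  simpa using artinSection_wordProd (cs := cs) (ω := []) (by simp [CoxeterSystem.IsReduced])

theorem artinSection_simple_mul {w : W} {i : B} (h : ¬ cs.IsLeftDescent w i) :
    cs.artinSection (cs.simple i * w) = M.artinGenerator i * cs.artinSection w := by
  obtain ⟨ω, hω, rfl⟩ := cs.exists_isReduced w
  rw [not_isLeftDescent_iff, hω.eq] at h
  have hcons : cs.IsReduced (i :: ω) := by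
    rw [CoxeterSystem.IsReduced, wordProd_cons, h, List.length_cons]
  rw [artinSection_wordProd hω, ← wordProd_cons, artinSection_wordProd hcons, List.map_cons,
    List.prod_cons]

variable (cs) in
theorem artinProj_artinGenerator (i : B) : cs.artinProj (M.artinGenerator i) = cs.simple i :=
  PresentedGroup.toGroup.of _

end CoxeterGroup

namespace MarinDatum

open CoxeterSystem CoxeterGroup

section MarinAlgebra

variable {k : Type*} [CommRing k] {B W : Type*} [Group W] {M : CoxeterMatrix B}
  {cs : CoxeterSystem M W} {A : Type*} [CommRing A] [Algebra k A] (D : MarinDatum k cs A)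

/-! ### The universal property of a Marin algebra -/

/-- The inclusion of `A` in the Marin algebra, as an algebra homomorphism. -/
def coeffHom : A →ₐ[k] D.Alg :=
  D.proj.comp
    { SkewMonoidAlgebra.singleOneRingHom with
      commutes' := fun _ => rfl }

theorem coeffHom_apply (c : A) : D.coeffHom c = D.coeff c := rfl

/-- The canonical map from the Artin braid group to the Marin algebra. -/
def braidHom : M.ArtinGroup →* D.Alg :=
  (D.proj : D.SemidirectProduct →* D.Alg).comp
    ((SkewMonoidAlgebra.of A D.BraidGroup).comp D.toBraidGroup.toMonoidHom)

theorem braidHom_apply (x : M.ArtinGroup) : D.braidHom x = D.proj (D.inclB x) := rfl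

theorem braidHom_artinSection (w : W) : D.braidHom (cs.artinSection w) = D.g w := rfl

theorem braidHom_mul_coeffHom (x : M.ArtinGroup) (c : A) :
    D.braidHom x * D.coeffHom c = D.coeffHom (D.ρ (cs.artinProj x) c) * D.braidHom x := by
  simp only [coeffHom_apply, braidHom_apply, coeff, ← map_mul, inclA, inclB,
    SkewMonoidAlgebra.single_mul_single, braidGroup_smul_def, one_mul, mul_one, map_one,
    MulEquiv.symm_apply_apply]

theorem braidHom_artinGenerator_sq (i : B) :
    D.braidHom (M.artinGenerator i) ^ 2 =
      D.coeffHom (D.a i) + D.coeffHom (1 - D.a i) * D.braidHom (M.artinGenerator i) := by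
  simp only [coeffHom_apply, braidHom_apply, coeff, ← map_mul, ← map_pow, ← map_add]
  exact RingQuot.mkAlgHom_rel k (Rel.quadratic i)

section Lift

variable {R : Type*} [Ring R] [Algebra k R] (φ : A →ₐ[k] R) (T : M.ArtinGroup →* Rˣ)

theorem semiconjBy_of_artinGenerator
    (hT : ∀ i c, SemiconjBy (T (M.artinGenerator i) : R) (φ c) (φ (D.ρ (cs.simple i) c)))
    (x : M.ArtinGroup) (c : A) : SemiconjBy (T x : R) (φ c) (φ (D.ρ (cs.artinProj x) c)) := by
  let H : Subgroup M.ArtinGroup :=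
    { carrier := {x | ∀ c, SemiconjBy (T x : R) (φ c) (φ (D.ρ (cs.artinProj x) c))}
      one_mem' := fun c => by simp
      mul_mem' := fun {x y} hx hy c => by
        simpa only [map_mul, Units.val_mul, AlgEquiv.mul_apply] using (hx _).mul_left (hy c)
      inv_mem' := fun {x} hx c => by
        have h := hx (D.ρ (cs.artinProj x)⁻¹ c)
        rw [← AlgEquiv.mul_apply, ← map_mul, mul_inv_cancel, map_one, AlgEquiv.one_apply] at h
        rw [map_inv, map_inv]
        exact h.units_inv_symm_left }
  refine PresentedGroup.generated_by _ H (fun i c => ?_) x c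
  exact (artinProj_artinGenerator cs i).symm ▸ hT i c

/-- The homomorphism from the semidirect product `A ⋊ k[B_W]` that extends an algebra homomorphism
on `A` and a group homomorphism on `B_W`. -/
def semidirectLift
    (hT : ∀ i c, SemiconjBy (T (M.artinGenerator i) : R) (φ c) (φ (D.ρ (cs.simple i) c))) :
    D.SemidirectProduct →ₐ[k] R :=
  SkewMonoidAlgebra.liftNCAlgHom φ
    ((Units.coeHom R).comp (T.comp D.toBraidGroup.symm.toMonoidHom))
    (fun {c x} => (D.semiconjBy_of_artinGenerator φ T hT (D.toBraidGroup.symm x) c).eq.symm)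

variable {φ T}
variable (hT : ∀ i c, SemiconjBy (T (M.artinGenerator i) : R) (φ c) (φ (D.ρ (cs.simple i) c)))

theorem semidirectLift_inclA (c : A) : D.semidirectLift φ T hT (D.inclA c) = φ c := by
  refine (SkewMonoidAlgebra.liftNC_single _ _ _ _).trans ?_
  simp

theorem semidirectLift_inclB (x : M.ArtinGroup) :
    D.semidirectLift φ T hT (D.inclB x) = T x := by
  refine (SkewMonoidAlgebra.liftNC_single _ _ _ _).trans ?_
  simp

variable (hquad : ∀ i, (T (M.artinGenerator i) : R) ^ 2 =
  φ (D.a i) + φ (1 - D.a i) * T (M.artinGenerator i))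

/-- The homomorphism from a Marin algebra defined by an algebra homomorphism on `A` and a group
homomorphism on the Artin braid group that satisfy the relations on generators. -/
def lift : D.Alg →ₐ[k] R :=
  RingQuot.liftAlgHom k ⟨D.semidirectLift φ T hT, by
    rintro _ _ ⟨i⟩
    simpa only [map_pow, map_add, map_mul, semidirectLift_inclA, semidirectLift_inclB] using
      hquad i⟩

theorem lift_coeffHom (c : A) : D.lift hT hquad (D.coeffHom c) = φ c :=
  (RingQuot.liftAlgHom_mkAlgHom_apply k _ _ _).trans (D.semidirectLift_inclA hT c)

theorem lift_braidHom (x : M.ArtinGroup) : D.lift hT hquad (D.braidHom x) = T x :=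
  (RingQuot.liftAlgHom_mkAlgHom_apply k _ _ _).trans (D.semidirectLift_inclB hT x)

end Lift

/-! ### The regular representation of a Marin algebra -/

/-- The condition `(1 - a_s) (1 - ρ_s) = 0` in `End_k(A)`, for all `s`, under which the elements
`g_w` are linearly independent over `A` in the Marin algebra. -/
def IsAdmissible : Prop :=
  ∀ i : B, (LinearMap.mulLeft k (1 - (D.a i : A)) : Module.End k A) *
    (1 - (D.ρ (cs.simple i)).toLinearMap) = 0

variable {D} in
theorem IsAdmissible.one_sub_a_mul_rho (hD : D.IsAdmissible) (i : B) (x : A) :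
    (1 - (D.a i : A)) * D.ρ (cs.simple i) x = (1 - (D.a i : A)) * x := by
  have h := LinearMap.congr_fun (hD i) x
  simp only [Module.End.mul_apply, LinearMap.mulLeft_apply, LinearMap.sub_apply,
    Module.End.one_apply, AlgEquiv.toLinearMap_apply, LinearMap.zero_apply] at h
  linear_combination -h

theorem rho_simple_a (i : B) : D.ρ (cs.simple i) (D.a i : A) = D.a i :=
  D.equivariant i i (cs.simple i) (by simp)

theorem rho_simple_rho_simple (i : B) (x : A) :
    D.ρ (cs.simple i) (D.ρ (cs.simple i) x) = x := by
  rw [← AlgEquiv.mul_apply, ← map_mul, cs.simple_mul_simple_self, map_one, AlgEquiv.one_apply]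

open scoped Classical in
/-- The coefficient `p` in `g_s g_w = p g_{sw} + (1 - p) g_w`. -/
def leftWeight (i : B) (w : W) : A :=
  if cs.IsLeftDescent w i then D.a i else 1

open scoped Classical in
/-- The coefficient `q` in `g_w g_s = q g_{ws} + (1 - q) g_w`. -/
def rightWeight (i : B) (w : W) : A :=
  if cs.IsRightDescent w i then D.ρ w (D.a i) else 1

theorem leftWeight_add_leftWeight_simple_mul (i : B) (w : W) :
    D.leftWeight i w + D.leftWeight i (cs.simple i * w) = 1 + D.a i := by
  have h := cs.isLeftDescent_iff_not_isLeftDescent_mul (w := w) (i := i)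
  by_cases hw : cs.IsLeftDescent w i
  · rw [leftWeight, leftWeight, if_pos hw, if_neg (h.mp hw), add_comm]
  · rw [leftWeight, leftWeight, if_neg hw, if_pos (not_not.mp (mt h.mpr hw))]

theorem rho_simple_leftWeight (i : B) (w : W) :
    D.ρ (cs.simple i) (D.leftWeight i w) = D.leftWeight i w := by
  unfold leftWeight
  split_ifs
  · exact D.rho_simple_a i
  · exact map_one _

variable {D} in
theorem IsAdmissible.one_sub_leftWeight_mul_rho (hD : D.IsAdmissible) (i : B) (w : W) (x : A) :
    (1 - D.leftWeight i w) * D.ρ (cs.simple i) x = (1 - D.leftWeight i w) * x := by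
  unfold leftWeight
  split_ifs
  · exact hD.one_sub_a_mul_rho i x
  · rw [sub_self, zero_mul, zero_mul]

open scoped Classical in
theorem leftWeight_mul_simple {i j : B} {w : W} (h : cs.simple i * w ≠ w * cs.simple j) :
    D.leftWeight i (w * cs.simple j) = D.leftWeight i w :=
  if_congr (isLeftDescent_mul_simple_iff h) rfl rfl

open scoped Classical in
theorem rightWeight_simple_mul {i j : B} {w : W} (h : cs.simple i * w ≠ w * cs.simple j) :
    D.rightWeight j (cs.simple i * w) = D.ρ (cs.simple i) (D.rightWeight j w) := by
  rw [rightWeight, rightWeight, if_congr (isRightDescent_simple_mul_iff h) rfl rfl, map_mul,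
    AlgEquiv.mul_apply, apply_ite (D.ρ (cs.simple i)), map_one]

theorem rightWeight_eq_leftWeight {i j : B} {w : W} (h : cs.simple i * w = w * cs.simple j) :
    D.rightWeight j w = D.leftWeight i w := by
  unfold rightWeight leftWeight
  rw [D.equivariant j i w (by rw [← h, mul_inv_cancel_right]), IsRightDescent, IsLeftDescent, h]

/-- The left multiplication by the generator `g_s` on the free `A`-module with basis `g_w`. -/
def leftOp (i : B) : Module.End k (W →₀ A) :=
  Finsupp.lsum k fun w =>
    (Finsupp.lsingle (cs.simple i * w) ∘ₗ LinearMap.mulLeft k (D.leftWeight i w) +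
      Finsupp.lsingle w ∘ₗ LinearMap.mulLeft k (1 - D.leftWeight i w)) ∘ₗ
        (D.ρ (cs.simple i)).toLinearMap

/-- The right multiplication by the generator `g_s` on the free `A`-module with basis `g_w`. -/
def rightOp (i : B) : Module.End k (W →₀ A) :=
  Finsupp.lsum k fun w =>
    Finsupp.lsingle (w * cs.simple i) ∘ₗ LinearMap.mulLeft k (D.rightWeight i w) +
      Finsupp.lsingle w ∘ₗ LinearMap.mulLeft k (1 - D.rightWeight i w)

theorem leftOp_single (i : B) (w : W) (c : A) :
    D.leftOp i (Finsupp.single w c) =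
      Finsupp.single (cs.simple i * w) (D.leftWeight i w * D.ρ (cs.simple i) c) +
        Finsupp.single w ((1 - D.leftWeight i w) * D.ρ (cs.simple i) c) := by
  simp [leftOp]

theorem rightOp_single (i : B) (w : W) (c : A) :
    D.rightOp i (Finsupp.single w c) =
      Finsupp.single (w * cs.simple i) (D.rightWeight i w * c) +
        Finsupp.single w ((1 - D.rightWeight i w) * c) := by
  simp [rightOp]

theorem leftOp_single_of_not_isLeftDescent {i : B} {w : W} (h : ¬ cs.IsLeftDescent w i) (c : A) :
    D.leftOp i (Finsupp.single w c) =
      Finsupp.single (cs.simple i * w) (D.ρ (cs.simple i) c) := by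
  simp [leftOp_single, leftWeight, h]

theorem rightOp_single_of_not_isRightDescent {i : B} {w : W} (h : ¬ cs.IsRightDescent w i)
    (c : A) : D.rightOp i (Finsupp.single w c) = Finsupp.single (w * cs.simple i) c := by
  simp [rightOp_single, rightWeight, h]

theorem leftOp_smul (i : B) (c : A) (v : W →₀ A) :
    D.leftOp i (c • v) = D.ρ (cs.simple i) c • D.leftOp i v := by
  induction v using Finsupp.induction_linear with
  | zero => simp only [smul_zero, map_zero]
  | add x y hx hy => simp only [smul_add, map_add, hx, hy]
  | single w x =>
    simp only [Finsupp.smul_single, leftOp_single, smul_add, smul_eq_mul, map_mul,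
      mul_left_comm (D.ρ (cs.simple i) c)]

variable {D}

theorem IsAdmissible.leftOp_leftOp (hD : D.IsAdmissible) (i : B) (v : W →₀ A) :
    D.leftOp i (D.leftOp i v) = (D.a i : A) • v + (1 - (D.a i : A)) • D.leftOp i v := by
  induction v using Finsupp.induction_linear with
  | zero => simp only [map_zero, smul_zero, add_zero]
  | add x y hx hy =>
    simp only [map_add, smul_add, hx, hy]
    abel
  | single w x =>
    simp only [leftOp_single, map_add, map_mul, map_sub, map_one, rho_simple_leftWeight,
      rho_simple_rho_simple, cs.simple_mul_simple_cancel_left, smul_add, Finsupp.smul_single,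
      smul_eq_mul]
    set p := D.leftWeight i w
    set p' := D.leftWeight i (cs.simple i * w)
    set y := D.ρ (cs.simple i) x
    have hxy : (1 - (D.a i : A)) * y = (1 - (D.a i : A)) * x := hD.one_sub_a_mul_rho i x
    have hadd : p + p' = 1 + D.a i := D.leftWeight_add_leftWeight_simple_mul i w
    have coeff_left : (1 - p') * (p * x) + p * ((1 - p) * x) = (1 - D.a i) * (p * y) := by
      linear_combination (-p) * hxy - p * x * hadd
    have coeff_self : p' * (p * x) + (1 - p) * ((1 - p) * x) =
        D.a i * x + (1 - D.a i) * ((1 - p) * y) := by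
      linear_combination (p - 1) * hxy + p * x * hadd
    rw [← coeff_left, add_left_comm (Finsupp.single w (D.a i * x)), ← Finsupp.single_add,
      ← coeff_self]
    simp only [Finsupp.single_add]
    abel

/-- Left and right multiplications commute; in the critical case `sw = wt` they act on
`g_w` by the same formula. -/
theorem IsAdmissible.commute_leftOp_rightOp (hD : D.IsAdmissible) (i j : B) :
    Commute (D.leftOp i) (D.rightOp j) := by
  refine LinearMap.ext fun v => ?_
  simp only [Module.End.mul_apply]
  induction v using Finsupp.induction_linear with
  | zero => simp only [map_zero]
  | add x y hx hy => simp only [map_add, hx, hy]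
  | single w x =>
    by_cases h : cs.simple i * w = w * cs.simple j
    · have h' : cs.simple i * (w * cs.simple j) = w * cs.simple j * cs.simple j := by
        rw [← mul_assoc, h]
      simp only [rightOp_single, leftOp_single, map_add, D.rightWeight_eq_leftWeight h,
        D.rightWeight_eq_leftWeight h', h, h', map_mul, map_sub, map_one, rho_simple_leftWeight]
    · simp only [rightOp_single, leftOp_single, map_add, D.leftWeight_mul_simple h,
        D.rightWeight_simple_mul h, map_mul, map_sub, map_one, mul_assoc]
      set p := D.leftWeight i w
      set q := D.rightWeight j w
      set y := D.ρ (cs.simple i) x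
      have hq : (1 - p) * D.ρ (cs.simple i) q = (1 - p) * q := hD.one_sub_leftWeight_mul_rho i w q
      have coeff_right : (1 - p) * (D.ρ (cs.simple i) q * y) = q * ((1 - p) * y) := by
        linear_combination y * hq
      have coeff_self : (1 - p) * ((1 - D.ρ (cs.simple i) q) * y) = (1 - q) * ((1 - p) * y) := by
        linear_combination (-y) * hq
      rw [coeff_right, coeff_self, mul_left_comm p, mul_left_comm p]
      abel

theorem end_ext_of_commute_rightOp {σ : A → A} {X Y : Module.End k (W →₀ A)}
    (hXσ : ∀ (c : A) v, X (c • v) = σ c • X v) (hYσ : ∀ (c : A) v, Y (c • v) = σ c • Y v)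
    (hX : ∀ j, Commute X (D.rightOp j)) (hY : ∀ j, Commute Y (D.rightOp j))
    (h : X (Finsupp.single 1 1) = Y (Finsupp.single 1 1)) : X = Y := by
  have h_single (w : W) : X (Finsupp.single w 1) = Y (Finsupp.single w 1) := by
    induction w using ascent_induction_right cs with
    | one => exact h
    | mul_simple w j hj ih =>
      rw [← D.rightOp_single_of_not_isRightDescent hj, ← Module.End.mul_apply,
        ← Module.End.mul_apply, (hX j).eq, (hY j).eq, Module.End.mul_apply, Module.End.mul_apply,
        ih]
  refine Finsupp.lhom_ext fun w x => ?_
  rw [← mul_one x, ← smul_eq_mul, ← Finsupp.smul_single, hXσ, hYσ, h_single]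

variable (D) in
theorem prod_leftOp_smul (ω : List B) (c : A) (v : W →₀ A) :
    (ω.map D.leftOp).prod (c • v) = D.ρ (cs.wordProd ω) c • (ω.map D.leftOp).prod v := by
  induction ω with
  | nil => simp
  | cons i ω ih =>
    rw [List.map_cons, List.prod_cons, Module.End.mul_apply, Module.End.mul_apply, ih,
      leftOp_smul, wordProd_cons, map_mul, AlgEquiv.mul_apply]

variable (D) in
theorem prod_leftOp_single_one {ω : List B} (h : cs.IsReduced ω) :
    (ω.map D.leftOp).prod (Finsupp.single 1 1) = Finsupp.single (cs.wordProd ω) 1 := by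
  induction ω with
  | nil => simp
  | cons i ω ih =>
    have hω : cs.IsReduced ω := by simpa using h.drop 1
    have hi : ¬ cs.IsLeftDescent (cs.wordProd ω) i := by
      rw [not_isLeftDescent_iff, ← wordProd_cons, h.eq, hω.eq, List.length_cons]
    rw [List.map_cons, List.prod_cons, Module.End.mul_apply, ih hω,
      leftOp_single_of_not_isLeftDescent _ hi, map_one, wordProd_cons]

theorem IsAdmissible.prod_leftOp_eq (hD : D.IsAdmissible) {ω ω' : List B} (h : cs.IsReduced ω)
    (h' : cs.IsReduced ω') (he : cs.wordProd ω = cs.wordProd ω') :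
    (ω.map D.leftOp).prod = (ω'.map D.leftOp).prod := by
  have commute_prod (ν : List B) (j : B) : Commute (ν.map D.leftOp).prod (D.rightOp j) := by
    refine Commute.list_prod_left _ _ fun _ hx => ?_
    obtain ⟨i, -, rfl⟩ := List.mem_map.mp hx
    exact hD.commute_leftOp_rightOp i j
  refine end_ext_of_commute_rightOp (D.prod_leftOp_smul ω) (he ▸ D.prod_leftOp_smul ω')
    (commute_prod ω) (commute_prod ω') ?_
  rw [D.prod_leftOp_single_one h, D.prod_leftOp_single_one h', he]

theorem IsAdmissible.isUnit_leftOp (hD : D.IsAdmissible) (i : B) : IsUnit (D.leftOp i) := by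
  rw [Module.End.isUnit_iff]
  constructor
  · refine (injective_iff_map_eq_zero _).mpr fun v hv => ?_
    have h : (D.a i : A) • v = 0 := by simpa [hv] using (hD.leftOp_leftOp i v).symm
    exact (smul_eq_zero_iff_eq (D.a i)).mp h
  · intro v
    obtain ⟨u, rfl⟩ : ∃ u, (D.a i : A) • u = v := ⟨(D.a i)⁻¹ • v, smul_inv_smul (D.a i) v⟩
    refine ⟨D.leftOp i u - (1 - (D.a i : A)) • u, ?_⟩
    rw [map_sub, hD.leftOp_leftOp, leftOp_smul, map_sub, map_one, rho_simple_a,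
      add_sub_cancel_right]

/-- The action of the Artin braid group on the free `A`-module with basis `g_w`, in which the
generators act by `leftOp`. -/
def artinRep (hD : D.IsAdmissible) : M.ArtinGroup →* (Module.End k (W →₀ A))ˣ :=
  PresentedGroup.toGroup (f := fun i => (hD.isUnit_leftOp i).unit) <| by
    have val_lift (ω : List B) : ((FreeGroup.lift (fun i => (hD.isUnit_leftOp i).unit)
        (ω.map FreeGroup.of).prod : (Module.End k (W →₀ A))ˣ) : Module.End k (W →₀ A)) =
          (ω.map D.leftOp).prod := by
      rw [map_list_prod, ← Units.coeHom_apply, map_list_prod]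
      simp only [List.map_map, Function.comp_def, FreeGroup.lift_apply_of, Units.coeHom_apply,
        IsUnit.unit_spec]
    rintro _ ⟨i, j, -, rfl⟩
    rw [map_mul, map_inv, mul_inv_eq_one]
    rcases eq_or_ne i j with rfl | hij
    · rfl
    refine Units.ext ?_
    rw [val_lift, val_lift]
    exact hD.prod_leftOp_eq (isReduced_alternatingWord hij (.inr le_rfl))
      (isReduced_alternatingWord hij.symm (.inr le_rfl)) (cs.wordProd_braidWord_eq i j)

theorem artinRep_artinGenerator (hD : D.IsAdmissible) (i : B) :
    (artinRep hD (M.artinGenerator i) : Module.End k (W →₀ A)) = D.leftOp i :=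
  congrArg Units.val (PresentedGroup.toGroup.of _)

theorem artinRep_artinSection_single_one (hD : D.IsAdmissible) (w : W) :
    (artinRep hD (cs.artinSection w) : Module.End k (W →₀ A)) (Finsupp.single 1 1) =
      Finsupp.single w 1 := by
  induction w using ascent_induction_left cs with
  | one => rw [artinSection_one, map_one, Units.val_one, Module.End.one_apply]
  | simple_mul w i hi ih =>
    rw [artinSection_simple_mul hi, map_mul, Units.val_mul, Module.End.mul_apply, ih,
      artinRep_artinGenerator, leftOp_single_of_not_isLeftDescent _ hi, map_one]

theorem IsAdmissible.semiconjBy_artinRep (hD : D.IsAdmissible) (i : B) (c : A) :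
    SemiconjBy (artinRep hD (M.artinGenerator i) : Module.End k (W →₀ A))
      (Algebra.lsmul k k (W →₀ A) c) (Algebra.lsmul k k (W →₀ A) (D.ρ (cs.simple i) c)) := by
  rw [artinRep_artinGenerator]
  exact LinearMap.ext (D.leftOp_smul i c)

theorem IsAdmissible.artinRep_artinGenerator_sq (hD : D.IsAdmissible) (i : B) :
    (artinRep hD (M.artinGenerator i) : Module.End k (W →₀ A)) ^ 2 =
      Algebra.lsmul k k (W →₀ A) (D.a i : A) + Algebra.lsmul k k (W →₀ A) (1 - (D.a i : A)) *
        artinRep hD (M.artinGenerator i) := by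
  rw [artinRep_artinGenerator, pow_two]
  exact LinearMap.ext (hD.leftOp_leftOp i)

/-- The regular representation of the Marin algebra, on the free `A`-module with basis `g_w`. -/
def rep (hD : D.IsAdmissible) : D.Alg →ₐ[k] Module.End k (W →₀ A) :=
  D.lift (R := Module.End k (W →₀ A)) hD.semiconjBy_artinRep hD.artinRep_artinGenerator_sq

theorem rep_coeff_mul_g_single_one (hD : D.IsAdmissible) (c : A) (w : W) :
    rep hD (D.coeff c * D.g w) (Finsupp.single 1 1) = Finsupp.single w c := by
  rw [← coeffHom_apply, ← braidHom_artinSection, map_mul, rep, lift_coeffHom, lift_braidHom,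
    Module.End.mul_apply, artinRep_artinSection_single_one]
  change c • Finsupp.single w (1 : A) = _
  rw [Finsupp.smul_single, smul_eq_mul, mul_one]

/-! ### The standard basis of a Marin algebra -/

variable (D)

theorem g_one : D.g 1 = 1 := by
  rw [← braidHom_artinSection, artinSection_one, map_one]

theorem g_simple_mul {w : W} {i : B} (h : ¬ cs.IsLeftDescent w i) :
    D.g (cs.simple i * w) = D.braidHom (M.artinGenerator i) * D.g w := by
  rw [← braidHom_artinSection, artinSection_simple_mul h, map_mul, braidHom_artinSection]

theorem braidHom_artinGenerator_mul_g (i : B) (w : W) :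
    D.braidHom (M.artinGenerator i) * D.g w =
      D.coeffHom (D.leftWeight i w) * D.g (cs.simple i * w) +
        D.coeffHom (1 - D.leftWeight i w) * D.g w := by
  by_cases h : cs.IsLeftDescent w i
  · have hg : D.g w = D.braidHom (M.artinGenerator i) * D.g (cs.simple i * w) := by
      rw [← D.g_simple_mul (cs.isLeftDescent_iff_not_isLeftDescent_mul.mp h),
        cs.simple_mul_simple_cancel_left]
    rw [hg, ← mul_assoc, ← pow_two, braidHom_artinGenerator_sq, leftWeight, if_pos h, add_mul,
      mul_assoc]
  · rw [leftWeight, if_neg h, g_simple_mul D h, map_one, one_mul, sub_self, map_zero, zero_mul,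
      add_zero]

/-- The `k`-linear map from the free `A`-module on `W` to the Marin algebra that takes the basis
vector of `w` to `g_w`. -/
def fromFree : (W →₀ A) →ₗ[k] D.Alg :=
  Finsupp.lsum k fun w => LinearMap.mulRight k (D.g w) ∘ₗ D.coeffHom.toLinearMap

theorem fromFree_single (w : W) (c : A) :
    D.fromFree (Finsupp.single w c) = D.coeffHom c * D.g w := by
  simp [fromFree]

theorem fromFree_smul (c : A) (v : W →₀ A) :
    D.fromFree (c • v) = D.coeffHom c * D.fromFree v := by
  induction v using Finsupp.induction_linear with
  | zero => simp only [smul_zero, map_zero, mul_zero]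
  | add x y hx hy => rw [smul_add, map_add, map_add, mul_add, hx, hy]
  | single w y =>
    rw [Finsupp.smul_single, fromFree_single, fromFree_single, smul_eq_mul, map_mul, mul_assoc]

theorem fromFree_leftOp (i : B) (v : W →₀ A) :
    D.fromFree (D.leftOp i v) = D.braidHom (M.artinGenerator i) * D.fromFree v := by
  induction v using Finsupp.induction_linear with
  | zero => simp only [map_zero, mul_zero]
  | add x y hx hy => rw [map_add, map_add, map_add, mul_add, hx, hy]
  | single w y =>
    rw [leftOp_single, map_add, fromFree_single, fromFree_single, fromFree_single, ← mul_assoc,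
      braidHom_mul_coeffHom, artinProj_artinGenerator, mul_assoc, braidHom_artinGenerator_mul_g,
      mul_add]
    simp only [map_mul, ← mul_assoc, mul_comm (D.leftWeight i w), mul_comm (1 - D.leftWeight i w)]

theorem coeffHom_mul_mem_range_fromFree (c : A) {x : D.Alg}
    (hx : x ∈ LinearMap.range D.fromFree) : D.coeffHom c * x ∈ LinearMap.range D.fromFree := by
  obtain ⟨v, rfl⟩ := hx
  exact ⟨c • v, D.fromFree_smul c v⟩

theorem braidHom_artinGenerator_mul_mem_range_fromFree (i : B) {x : D.Alg}
    (hx : x ∈ LinearMap.range D.fromFree) :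
    D.braidHom (M.artinGenerator i) * x ∈ LinearMap.range D.fromFree := by
  obtain ⟨v, rfl⟩ := hx
  exact ⟨D.leftOp i v, D.fromFree_leftOp i v⟩

/-- As `T (T x) = a x + (1 - a) T x` with `a` invertible, `x` can be recovered from `T x`. -/
theorem braidHom_artinGenerator_mul_mem_range_fromFree_iff (i : B) (x : D.Alg) :
    D.braidHom (M.artinGenerator i) * x ∈ LinearMap.range D.fromFree ↔
      x ∈ LinearMap.range D.fromFree := by
  refine ⟨fun hx => ?_, D.braidHom_artinGenerator_mul_mem_range_fromFree i⟩
  set T := D.braidHom (M.artinGenerator i)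
  have hax : D.coeffHom (D.a i) * x = T * (T * x) - D.coeffHom (1 - D.a i) * (T * x) := by
    rw [← mul_assoc, ← pow_two, braidHom_artinGenerator_sq, add_mul, mul_assoc,
      add_sub_cancel_right]
  have hmem : D.coeffHom (D.a i) * x ∈ LinearMap.range D.fromFree :=
    hax ▸ sub_mem (D.braidHom_artinGenerator_mul_mem_range_fromFree i hx)
      (D.coeffHom_mul_mem_range_fromFree _ hx)
  simpa only [← mul_assoc, ← map_mul, Units.inv_mul, map_one, one_mul] using
    D.coeffHom_mul_mem_range_fromFree ((D.a i)⁻¹ : Aˣ) hmem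

theorem braidHom_mul_mem_range_fromFree_iff (g : M.ArtinGroup) (x : D.Alg) :
    D.braidHom g * x ∈ LinearMap.range D.fromFree ↔ x ∈ LinearMap.range D.fromFree := by
  let H : Subgroup M.ArtinGroup :=
    { carrier := {g | ∀ x, D.braidHom g * x ∈ LinearMap.range D.fromFree ↔
        x ∈ LinearMap.range D.fromFree}
      one_mem' := fun x => by rw [map_one, one_mul]
      mul_mem' := fun {g h} hg hh x => by rw [map_mul, mul_assoc, hg, hh]
      inv_mem' := fun {g} hg x => by
        rw [← hg, ← mul_assoc, ← map_mul, mul_inv_cancel, map_one, one_mul] }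
  exact PresentedGroup.generated_by _ H D.braidHom_artinGenerator_mul_mem_range_fromFree_iff g x

theorem fromFree_surjective : Function.Surjective D.fromFree := by
  rw [← LinearMap.range_eq_top, eq_top_iff]
  rintro x -
  obtain ⟨y, rfl⟩ : ∃ y, D.proj y = x := RingQuot.mkAlgHom_surjective k D.Rel x
  induction y using SkewMonoidAlgebra.induction_on with
  | zero => exact map_zero D.proj ▸ zero_mem _
  | add f g hf hg => exact map_add D.proj f g ▸ add_mem hf hg
  | single g c =>
    have hsingle : D.proj (SkewMonoidAlgebra.single g c) =
        D.coeffHom c * D.braidHom (D.toBraidGroup.symm g) := by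
      simp [coeffHom_apply, braidHom_apply, coeff, ← map_mul, inclA, inclB,
        SkewMonoidAlgebra.single_mul_single]
    rw [hsingle, ← mul_one (D.braidHom _)]
    refine D.coeffHom_mul_mem_range_fromFree c ((D.braidHom_mul_mem_range_fromFree_iff _ 1).mpr ?_)
    exact ⟨Finsupp.single 1 1, by rw [fromFree_single, g_one, map_one, one_mul]⟩

variable {D}

theorem rep_fromFree_single_one (hD : D.IsAdmissible) (v : W →₀ A) :
    rep hD (D.fromFree v) (Finsupp.single 1 1) = v := by
  induction v using Finsupp.induction_linear with
  | zero => rw [map_zero, map_zero, LinearMap.zero_apply]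
  | add x y hx hy => rw [map_add, map_add, LinearMap.add_apply, hx, hy]
  | single w c => rw [fromFree_single, coeffHom_apply, rep_coeff_mul_g_single_one]

theorem IsAdmissible.fromFree_bijective (hD : D.IsAdmissible) : Function.Bijective D.fromFree :=
  ⟨(show Function.LeftInverse (fun x => rep hD x (Finsupp.single 1 1)) D.fromFree from
    rep_fromFree_single_one hD).injective, D.fromFree_surjective⟩

/-- The basis `(c_i g_w)` of a Marin algebra attached to a basis `(c_i)` of its coefficients. -/
def algBasis (hD : D.IsAdmissible) {I : Type*} (c : Module.Basis I k A) :
    Module.Basis (I × W) k D.Alg :=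
  ((Finsupp.basis fun _ : W => c).reindex
    ((Equiv.sigmaEquivProd W I).trans (Equiv.prodComm W I))).map
      (LinearEquiv.ofBijective D.fromFree hD.fromFree_bijective)

theorem algBasis_apply (hD : D.IsAdmissible) {I : Type*} (c : Module.Basis I k A) (i : I) (w : W) :
    algBasis hD c (i, w) = D.coeff (c i) * D.g w := by
  rw [← coeffHom_apply, ← fromFree_single]
  simp [algBasis]

theorem IsAdmissible.free_alg (hD : D.IsAdmissible) [Module.Free k A] : Module.Free k D.Alg :=
  Module.Free.of_basis (algBasis hD (Module.Free.chooseBasis k A))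

variable (D) in
theorem finite_alg [Module.Finite k A] [Finite W] : Module.Finite k D.Alg :=
  Module.Finite.of_surjective D.fromFree D.fromFree_surjective

theorem IsAdmissible.finrank_alg (hD : D.IsAdmissible) [Module.Free k A] [Nontrivial k] :
    Module.finrank k D.Alg = Nat.card W * Module.finrank k A := by
  let c := Module.Free.chooseBasis k A
  rw [Module.finrank_eq_nat_card_basis (algBasis hD c), Nat.card_prod,
    Module.finrank_eq_nat_card_basis c, mul_comm]

end MarinAlgebra

theorem IsAdmissible.rank_alg {k : Type uk} [CommRing k] {B : Type uB} {W : Type uW}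
    [Group W] {M : CoxeterMatrix B} {cs : CoxeterSystem M W} {A : Type uA} [CommRing A]
    [Algebra k A] {D : MarinDatum k cs A} (hD : D.IsAdmissible) [Module.Free k A] [Nontrivial k] :
    Cardinal.lift.{uW} (Module.rank k D.Alg) =
      Cardinal.lift.{max uA uB} (Cardinal.mk W) *
        Cardinal.lift.{max uB uW} (Module.rank k A) := by
  have h := (LinearEquiv.ofBijective D.fromFree hD.fromFree_bijective).lift_rank_eq
  rw [rank_finsupp] at h
  rw [Cardinal.lift_mul, Cardinal.lift_lift, Cardinal.lift_lift] at h
  rw [← Cardinal.lift_umax.{max uA uB, uW}, ← Cardinal.lift_umax.{uA, max uB uW}, h]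
  exact congrFun Cardinal.lift_umax.{max uA uB, max uA uW} _

end MarinDatum

namespace CoxeterGroup

open CoxeterSystem

/-! ### Root subsystems and reflection subgroups -/

variable {B W : Type*} [Group W] {M : CoxeterMatrix B} {cs : CoxeterSystem M W}

variable (cs) in
/-- `t` acts in the geometric representation as the reflection in the root `α`. -/
def IsReflectionAlong (t : W) (α : B →₀ ℝ) : Prop :=
  α ∈ cs.roots ∧ ∀ x, cs.geomRep t x = M.reflectionIn α x

theorem isReflectionAlong_conj_simple (w : W) (i : B) :
    IsReflectionAlong cs (w * cs.simple i * w⁻¹) (cs.geomRep w (M.simpleRoot i)) :=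
  ⟨⟨w, i, rfl⟩, geomRep_conj_simple w i⟩

theorem exists_isReflectionAlong {α : B →₀ ℝ} (hα : α ∈ cs.roots) :
    ∃ t, IsReflectionAlong cs t α := by
  obtain ⟨w, i, rfl⟩ := hα
  exact ⟨_, isReflectionAlong_conj_simple w i⟩

theorem exists_isReflectionAlong_of_isReflection {t : W} (ht : cs.IsReflection t) :
    ∃ α, IsReflectionAlong cs t α := by
  obtain ⟨w, i, rfl⟩ := ht
  exact ⟨_, isReflectionAlong_conj_simple w i⟩

namespace IsReflectionAlong

theorem eq {t r : W} {α : B →₀ ℝ} (ht : IsReflectionAlong cs t α)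
    (hr : IsReflectionAlong cs r α) : t = r :=
  geomRep_injective cs (LinearEquiv.ext fun x => (ht.2 x).trans (hr.2 x).symm)

theorem isReflection {t : W} {α : B →₀ ℝ} (ht : IsReflectionAlong cs t α) :
    cs.IsReflection t := by
  obtain ⟨w, i, rfl⟩ := ht.1
  exact ⟨w, i, ht.eq (isReflectionAlong_conj_simple w i)⟩

theorem conj {t : W} {α : B →₀ ℝ} (ht : IsReflectionAlong cs t α) (w : W) :
    IsReflectionAlong cs (w * t * w⁻¹) (cs.geomRep w α) := by
  refine ⟨cs.geomRep_mem_roots w ht.1, fun x => ?_⟩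
  rw [geomRep_mul_apply, geomRep_mul_apply, ht.2, geomRep_reflectionIn, ← geomRep_mul_apply,
    mul_inv_cancel, map_one, LinearEquiv.coe_one, id]

theorem neg {t : W} {α : B →₀ ℝ} (ht : IsReflectionAlong cs t α) :
    IsReflectionAlong cs t (-α) := by
  refine ⟨cs.neg_mem_roots ht.1, fun x => ?_⟩
  rw [ht.2, M.reflectionIn_apply, M.reflectionIn_apply]
  simp

theorem geomRep_self {t : W} {α : B →₀ ℝ} (ht : IsReflectionAlong cs t α) :
    cs.geomRep t α = -α := by
  rw [ht.2, cs.reflectionIn_root_self ht.1]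

theorem geomRep_geomRep {t : W} {α : B →₀ ℝ} (ht : IsReflectionAlong cs t α) (x : B →₀ ℝ) :
    cs.geomRep t (cs.geomRep t x) = x := by
  rw [← geomRep_mul_apply, ht.isReflection.mul_self, map_one, LinearEquiv.coe_one, id]

theorem eq_or_eq_neg {t : W} {α γ : B →₀ ℝ} (ht : IsReflectionAlong cs t α) (hγ : γ ∈ cs.roots)
    (h : cs.geomRep t γ = -γ) : γ = α ∨ γ = -α := by
  have hsmul : γ = M.geomForm α γ • α := by
    rw [ht.2, M.reflectionIn_apply, sub_eq_iff_eq_add, ← sub_eq_iff_eq_add', sub_neg_eq_add,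
      ← two_smul ℝ, mul_smul] at h
    exact smul_right_injective _ (two_ne_zero' ℝ) h
  have hsq : M.geomForm α γ * M.geomForm α γ = 1 := by
    rw [← cs.geomForm_root_self hγ]
    nth_rw 4 [hsmul]
    rw [map_smul, smul_eq_mul, M.geomForm_comm γ]
  rcases mul_self_eq_one_iff.mp hsq with h1 | h1 <;> rw [h1] at hsmul
  · exact Or.inl (hsmul.trans (one_smul _ _))
  · exact Or.inr (hsmul.trans (neg_one_smul _ _))

end IsReflectionAlong

theorem nonneg_or_nonpos {α : B →₀ ℝ} (hα : α ∈ cs.roots) : 0 ≤ α ∨ α ≤ 0 := by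
  obtain ⟨w, i, rfl⟩ := hα
  by_cases h : cs.IsRightDescent w i
  · exact Or.inr (geomRep_nonpos h)
  · exact Or.inl (geomRep_nonneg h)

theorem ne_zero_of_mem_roots {α : B →₀ ℝ} (hα : α ∈ cs.roots) : α ≠ 0 := by
  rintro rfl
  simpa using cs.geomForm_root_self hα

variable (cs) in
/-- The positive roots that `w` makes negative. -/
def inversions (w : W) : Set (B →₀ ℝ) := {γ ∈ cs.roots | 0 ≤ γ ∧ cs.geomRep w γ ≤ 0}

variable (cs) in
theorem finite_inversions (w : W) : (inversions cs w).Finite := by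
  induction w using cs.simple_induction_left with
  | one =>
    refine Set.finite_empty.subset fun γ hγ => ne_zero_of_mem_roots hγ.1 ?_
    exact le_antisymm (by simpa using hγ.2.2) hγ.2.1
  | mul_simple_left w i hw =>
    refine (hw.insert (cs.geomRep w⁻¹ (M.simpleRoot i))).subset ?_
    rintro γ ⟨hγ, hpos, hneg⟩
    rw [geomRep_mul_apply] at hneg
    have hwγ := cs.geomRep_mem_roots w hγ
    rcases nonneg_or_nonpos hwγ with h | h
    · left
      rw [← eq_simpleRoot_of_nonneg_of_nonpos hwγ h hneg, ← geomRep_mul_apply, inv_mul_cancel,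
        map_one, LinearEquiv.coe_one, id]
    · exact Or.inr ⟨hγ, hpos, h⟩

open scoped Classical in
/-- The sign of a root. -/
def rootSign (γ : B →₀ ℝ) : ℤˣ := if 0 ≤ γ then 1 else -1

theorem rootSign_of_nonneg {γ : B →₀ ℝ} (h : 0 ≤ γ) : rootSign γ = 1 := if_pos h

theorem rootSign_of_nonpos {γ : B →₀ ℝ} (hγ : γ ∈ cs.roots) (h : γ ≤ 0) : rootSign γ = -1 :=
  if_neg fun h' => ne_zero_of_mem_roots hγ (le_antisymm h h')

theorem rootSign_neg {γ : B →₀ ℝ} (hγ : γ ∈ cs.roots) : rootSign (-γ) = -rootSign γ := by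
  rcases nonneg_or_nonpos hγ with h | h
  · rw [rootSign_of_nonneg h, rootSign_of_nonpos (cs.neg_mem_roots hγ) (neg_nonpos.mpr h)]
  · rw [rootSign_of_nonpos hγ h, rootSign_of_nonneg (neg_nonneg.mpr h), neg_neg]

theorem rootSign_units_smul (u : ℤˣ) {γ : B →₀ ℝ} (hγ : γ ∈ cs.roots) :
    rootSign (u • γ) = u * rootSign γ := by
  rcases Int.units_eq_one_or u with rfl | rfl
  · rw [one_smul, one_mul]
  · rw [Units.neg_smul, one_smul, rootSign_neg hγ, neg_one_mul]

theorem rootSign_smul_self_nonneg {γ : B →₀ ℝ} (hγ : γ ∈ cs.roots) : 0 ≤ rootSign γ • γ := by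
  rcases nonneg_or_nonpos hγ with h | h
  · rwa [rootSign_of_nonneg h, one_smul]
  · rwa [rootSign_of_nonpos hγ h, Units.neg_smul, one_smul, neg_nonneg]

theorem geomRep_units_smul (w : W) (u : ℤˣ) (x : B →₀ ℝ) :
    cs.geomRep w (u • x) = u • cs.geomRep w x := by
  rw [Units.smul_def, Units.smul_def, map_zsmul]

theorem neg_mem_carrier (Ψ : cs.RootSubsystem) {α : B →₀ ℝ} (h : α ∈ Ψ.carrier) :
    -α ∈ Ψ.carrier := by
  rw [← cs.reflectionIn_root_self (Ψ.subset_roots h)]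
  exact Ψ.reflectionIn_mem α h α h

theorem units_smul_mem_carrier (Ψ : cs.RootSubsystem) (u : ℤˣ) {α : B →₀ ℝ}
    (h : α ∈ Ψ.carrier) : u • α ∈ Ψ.carrier := by
  rcases Int.units_eq_one_or u with rfl | rfl
  · rwa [one_smul]
  · rw [Units.neg_smul, one_smul]
    exact neg_mem_carrier Ψ h

theorem geomRep_mem_carrier {Ψ : cs.RootSubsystem} {w : W} (hw : w • Ψ = Ψ) {α : B →₀ ℝ}
    (h : α ∈ Ψ.carrier) : cs.geomRep w α ∈ Ψ.carrier := by
  rw [← hw, RootSubsystem.smul_carrier]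
  exact Set.mem_image_of_mem _ h

/-- The positive elements of a root subsystem. -/
def positiveRoots (Ψ : cs.RootSubsystem) : Set (B →₀ ℝ) := {γ ∈ Ψ.carrier | 0 ≤ γ}

theorem bijOn_rootSign_smul_geomRep {Ψ : cs.RootSubsystem} {h : W} (hh : h • Ψ = Ψ) :
    Set.BijOn (fun γ => rootSign (cs.geomRep h γ) • cs.geomRep h γ)
      (positiveRoots Ψ) (positiveRoots Ψ) := by
  have hmaps : ∀ {w : W}, w • Ψ = Ψ → Set.MapsTo
      (fun γ => rootSign (cs.geomRep w γ) • cs.geomRep w γ)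
      (positiveRoots Ψ) (positiveRoots Ψ) := fun hw γ hγ =>
    ⟨units_smul_mem_carrier Ψ _ (geomRep_mem_carrier hw hγ.1),
      rootSign_smul_self_nonneg (Ψ.subset_roots (geomRep_mem_carrier hw hγ.1))⟩
  have hinv : ∀ {v w : W}, v * w = 1 → Set.LeftInvOn
      (fun γ => rootSign (cs.geomRep v γ) • cs.geomRep v γ)
      (fun γ => rootSign (cs.geomRep w γ) • cs.geomRep w γ) (positiveRoots Ψ) := by
    rintro v w hvw γ hγ
    have hcancel : cs.geomRep v (cs.geomRep w γ) = γ := by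
      rw [← geomRep_mul_apply, hvw, map_one, LinearEquiv.coe_one, id]
    simp only [geomRep_units_smul, hcancel]
    rw [rootSign_units_smul _ (Ψ.subset_roots hγ.1), rootSign_of_nonneg hγ.2, mul_one, smul_smul,
      Int.units_mul_self, one_smul]
  exact Set.InvOn.bijOn ⟨hinv (inv_mul_cancel h), hinv (mul_inv_cancel h)⟩ (hmaps hh)
    (hmaps (inv_smul_eq_iff.mpr hh.symm))

/-- The parity of the number of positive elements of a root subsystem that `w` makes negative, as
a sign. -/
def inversionSign (Ψ : cs.RootSubsystem) (w : W) : ℤˣ :=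
  ∏ᶠ γ ∈ positiveRoots Ψ, rootSign (cs.geomRep w γ)

theorem finite_positiveRoots_inter_mulSupport (Ψ : cs.RootSubsystem) (w : W) :
    (positiveRoots Ψ ∩ Function.mulSupport fun γ => rootSign (cs.geomRep w γ)).Finite := by
  refine (finite_inversions cs w).subset ?_
  rintro γ ⟨hγ, hsign⟩
  have hroot := Ψ.subset_roots hγ.1
  exact ⟨hroot, hγ.2, (nonneg_or_nonpos (cs.geomRep_mem_roots w hroot)).resolve_left
    fun h => hsign (rootSign_of_nonneg h)⟩

theorem inversionSign_one (Ψ : cs.RootSubsystem) : inversionSign Ψ 1 = 1 :=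
  finprod_mem_eq_one_of_forall_eq_one fun γ hγ => rootSign_of_nonneg (by simpa using hγ.2)

theorem inversionSign_mul {Ψ : cs.RootSubsystem} (g : W) {h : W} (hh : h • Ψ = Ψ) :
    inversionSign Ψ (g * h) = inversionSign Ψ g * inversionSign Ψ h := by
  set absH := fun γ => rootSign (cs.geomRep h γ) • cs.geomRep h γ
  have hfactor : ∀ γ ∈ positiveRoots Ψ, rootSign (cs.geomRep g (absH γ)) =
      rootSign (cs.geomRep (g * h) γ) * rootSign (cs.geomRep h γ) := fun γ hγ => by
    rw [geomRep_units_smul, ← geomRep_mul_apply,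
      rootSign_units_smul _ (cs.geomRep_mem_roots _ (Ψ.subset_roots hγ.1)), mul_comm]
  have hg : inversionSign Ψ g = inversionSign Ψ (g * h) * inversionSign Ψ h := by
    rw [inversionSign, ← finprod_mem_eq_of_bijOn absH (bijOn_rootSign_smul_geomRep hh)
      fun γ hγ => (hfactor γ hγ).symm]
    exact finprod_mem_mul_distrib' (finite_positiveRoots_inter_mulSupport Ψ _)
      (finite_positiveRoots_inter_mulSupport Ψ _)
  rw [hg, mul_assoc, Int.units_mul_self, mul_one]

/-- The negative values come in pairs `γ`, `-t γ`, the only possible fixed point being `β`. -/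
theorem finprod_rootSign_geomRep_sdiff {Ψ : cs.RootSubsystem} {t : W} {β : B →₀ ℝ}
    (ht : IsReflectionAlong cs t β) (hβ : 0 ≤ β) (htΨ : t • Ψ = Ψ) :
    ∏ᶠ γ ∈ positiveRoots Ψ \ {β}, rootSign (cs.geomRep t γ) = 1 := by
  have hfin := (finite_positiveRoots_inter_mulSupport Ψ t).subset
    (Set.inter_subset_inter_left _ (Set.sdiff_subset (t := {β})))
  rw [finprod_mem_eq_prod _ hfin]
  have hnonpos : ∀ γ ∈ hfin.toFinset, cs.geomRep t γ ≤ 0 := fun γ hγ => by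
    obtain ⟨⟨hγ, -⟩, hsign⟩ := hfin.mem_toFinset.mp hγ
    exact (nonneg_or_nonpos (cs.geomRep_mem_roots t (Ψ.subset_roots hγ.1))).resolve_left
      fun h => hsign (rootSign_of_nonneg h)
  have hsign : ∀ γ ∈ hfin.toFinset, rootSign (cs.geomRep t γ) = -1 := fun γ hγ =>
    rootSign_of_nonpos (cs.geomRep_mem_roots t (Ψ.subset_roots (hfin.mem_toFinset.mp hγ).1.1.1))
      (hnonpos γ hγ)
  have hmem : ∀ γ ∈ hfin.toFinset, -cs.geomRep t γ ∈ hfin.toFinset := fun γ hγ => by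
    obtain ⟨⟨⟨hγΨ, hγ0⟩, hne⟩, -⟩ := hfin.mem_toFinset.mp hγ
    refine hfin.mem_toFinset.mpr
      ⟨⟨⟨neg_mem_carrier Ψ (geomRep_mem_carrier htΨ hγΨ), neg_nonneg.mpr (hnonpos γ hγ)⟩, ?_⟩, ?_⟩
    · intro heq
      refine hne ?_
      rw [Set.mem_singleton_iff, neg_eq_iff_eq_neg, ← ht.geomRep_self] at heq
      exact (cs.geomRep t).injective heq
    · rw [Function.mem_mulSupport, map_neg, ht.geomRep_geomRep, rootSign_neg (Ψ.subset_roots hγΨ),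
        rootSign_of_nonneg hγ0]
      decide
  refine Finset.prod_involution (fun γ _ => -cs.geomRep t γ) (fun γ hγ => ?_) (fun γ hγ _ heq => ?_)
    hmem fun γ _ => ?_
  · rw [hsign γ hγ, hsign _ (hmem γ hγ), Int.units_mul_self]
  · obtain ⟨⟨⟨hγΨ, hγ0⟩, hne⟩, -⟩ := hfin.mem_toFinset.mp hγ
    rcases ht.eq_or_eq_neg (Ψ.subset_roots hγΨ) (neg_eq_iff_eq_neg.mp heq) with h | h
    · exact hne h
    · exact ne_zero_of_mem_roots ht.1 (le_antisymm (neg_nonneg.mp (h ▸ hγ0)) hβ)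
  · rw [map_neg, neg_neg, ht.geomRep_geomRep]

theorem inversionSign_of_mem {Ψ : cs.RootSubsystem} {t : W} {β : B →₀ ℝ}
    (ht : IsReflectionAlong cs t β) (htΨ : t • Ψ = Ψ) (h : β ∈ Ψ.carrier) :
    inversionSign Ψ t = -1 := by
  wlog hβ : 0 ≤ β generalizing β
  · exact this ht.neg (neg_mem_carrier Ψ h)
      (neg_nonneg.mpr ((nonneg_or_nonpos ht.1).resolve_left hβ))
  have hinsert : positiveRoots Ψ = insert β (positiveRoots Ψ \ {β}) :=
    (Set.insert_sdiff_self_of_mem (show β ∈ positiveRoots Ψ from ⟨h, hβ⟩)).symm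
  rw [inversionSign, hinsert, finprod_mem_insert' _ (fun hmem => hmem.2 rfl),
    finprod_rootSign_geomRep_sdiff ht hβ htΨ, mul_one, ht.geomRep_self, rootSign_neg ht.1,
    rootSign_of_nonneg hβ]
  exact (finite_positiveRoots_inter_mulSupport Ψ t).subset
    (Set.inter_subset_inter_left _ Set.sdiff_subset)

theorem inversionSign_of_notMem {Ψ : cs.RootSubsystem} {t : W} {β : B →₀ ℝ}
    (ht : IsReflectionAlong cs t β) (htΨ : t • Ψ = Ψ) (h : β ∉ Ψ.carrier) :
    inversionSign Ψ t = 1 := by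
  wlog hβ : 0 ≤ β generalizing β
  · exact this ht.neg (fun hneg => h (neg_neg β ▸ neg_mem_carrier Ψ hneg))
      (neg_nonneg.mpr ((nonneg_or_nonpos ht.1).resolve_left hβ))
  rw [← finprod_rootSign_geomRep_sdiff ht hβ htΨ, inversionSign,
    Set.sdiff_singleton_eq_self fun hmem => h hmem.1]

/-- The reflections in the elements of a root subsystem. -/
def reflections (Ψ : cs.RootSubsystem) : Set W := {t | ∃ α ∈ Ψ.carrier, IsReflectionAlong cs t α}

theorem isReflection_of_mem_reflections {Ψ : cs.RootSubsystem} {t : W} (ht : t ∈ reflections Ψ) :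
    cs.IsReflection t := by
  obtain ⟨α, -, ht⟩ := ht
  exact ht.isReflection

theorem reflections_smul_eq {Ψ : cs.RootSubsystem} {t : W} (ht : t ∈ reflections Ψ) :
    t • Ψ = Ψ := by
  have hsub : (t • Ψ).carrier ⊆ Ψ.carrier := by
    obtain ⟨α, hα, ht⟩ := ht
    rintro _ ⟨γ, hγ, rfl⟩
    rw [ht.2]
    exact Ψ.reflectionIn_mem α hα γ hγ
  refine RootSubsystem.le_antisymm' hsub ?_
  have h := RootSubsystem.smul_mono t hsub
  rwa [← mul_smul, (isReflection_of_mem_reflections ht).mul_self, one_smul] at h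

/-- The subgroup generated by the reflections in the elements of a root subsystem. -/
def reflectionSubgroup (Ψ : cs.RootSubsystem) : Subgroup W := Subgroup.closure (reflections Ψ)

theorem smul_eq_of_mem_reflectionSubgroup {Ψ : cs.RootSubsystem} {w : W}
    (hw : w ∈ reflectionSubgroup Ψ) : w • Ψ = Ψ :=
  (Subgroup.closure_le (MulAction.stabilizer W Ψ)).mpr (fun _ => reflections_smul_eq) hw

theorem inversionSign_eq_neg_one_pow_length {Ψ : cs.RootSubsystem} {w : W}
    (hw : w ∈ reflectionSubgroup Ψ) : inversionSign Ψ w = (-1) ^ cs.length w := by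
  have hrefl : ∀ t ∈ reflections Ψ, inversionSign Ψ t = (-1) ^ cs.length t := fun t h => by
    rw [(isReflection_of_mem_reflections h).odd_length.neg_one_pow]
    have htΨ := reflections_smul_eq h
    obtain ⟨α, hα, ht⟩ := h
    exact inversionSign_of_mem ht htΨ hα
  induction hw using Subgroup.closure_induction'' with
  | mem t h => exact hrefl t h
  | inv_mem t h => exact (isReflection_of_mem_reflections h).inv.symm ▸ hrefl t h
  | one => rw [inversionSign_one, length_one, pow_zero]
  | mul g h _ hh ihg ihh =>
    rw [inversionSign_mul g (smul_eq_of_mem_reflectionSubgroup hh), ihg, ihh, ← pow_add,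
      Int.units_pow_eq_pow_mod_two, ← length_mul_mod_two, ← Int.units_pow_eq_pow_mod_two]

/-- On the reflection subgroup of `Ψ` the sign counting the inversions in `Ψ` agrees with the sign
of the length, which is `-1` on reflections; but it is `1` on a reflection along a root outside
`Ψ`. -/
theorem mem_carrier_iff_mem_reflectionSubgroup {Ψ : cs.RootSubsystem} {t : W} {β : B →₀ ℝ}
    (ht : IsReflectionAlong cs t β) : β ∈ Ψ.carrier ↔ t ∈ reflectionSubgroup Ψ := by
  refine ⟨fun h => Subgroup.subset_closure ⟨β, h, ht⟩, fun htΨ => by_contra fun h => ?_⟩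
  have hsign := inversionSign_of_notMem ht (smul_eq_of_mem_reflectionSubgroup htΨ) h
  rw [inversionSign_eq_neg_one_pow_length htΨ, ht.isReflection.odd_length.neg_one_pow] at hsign
  exact absurd hsign (by decide)

variable (cs) in
/-- The root subsystem of all roots whose reflection lies in a given subgroup. -/
def rootSubsystemOfSubgroup (H : Subgroup W) : cs.RootSubsystem where
  carrier := {α | ∃ t ∈ H, IsReflectionAlong cs t α}
  subset_roots := fun _ ⟨_, _, ht⟩ => ht.1
  reflectionIn_mem := by
    rintro α ⟨t, ht, htα⟩ β ⟨r, hr, hrβ⟩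
    exact ⟨t * r * t⁻¹, H.mul_mem (H.mul_mem ht hr) (H.inv_mem ht), htα.2 β ▸ hrβ.conj t⟩

theorem rootSubsystemOfSubgroup_reflectionSubgroup (Ψ : cs.RootSubsystem) :
    rootSubsystemOfSubgroup cs (reflectionSubgroup Ψ) = Ψ := by
  refine RootSubsystem.le_antisymm' ?_ fun α hα => ?_
  · rintro α ⟨t, ht, htα⟩
    exact (mem_carrier_iff_mem_reflectionSubgroup htα).mpr ht
  · obtain ⟨t, ht⟩ := exists_isReflectionAlong (Ψ.subset_roots hα)
    exact ⟨t, (mem_carrier_iff_mem_reflectionSubgroup ht).mp hα, ht⟩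

theorem reflectionSubgroup_rootSubsystemOfSubgroup_closure {T : Set W}
    (hT : ∀ t ∈ T, cs.IsReflection t) :
    reflectionSubgroup (rootSubsystemOfSubgroup cs (Subgroup.closure T)) = Subgroup.closure T := by
  refine le_antisymm ((Subgroup.closure_le _).mpr ?_) (Subgroup.closure_mono fun t ht => ?_)
  · rintro t ⟨α, ⟨r, hr, hrα⟩, htα⟩
    exact htα.eq hrα ▸ hr
  · obtain ⟨α, htα⟩ := exists_isReflectionAlong_of_isReflection (hT t ht)
    exact ⟨α, ⟨t, Subgroup.subset_closure ht, htα⟩, htα⟩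

variable (cs) in
/-- The subgroups of `W` generated by reflections. -/
def ReflectionSubgroup : Type _ :=
  {H : Subgroup W // ∃ T : Set W, (∀ t ∈ T, cs.IsReflection t) ∧ H = Subgroup.closure T}

variable (cs) in
/-- The correspondence between root subsystems and reflection subgroups. -/
def rootSubsystemEquiv : cs.RootSubsystem ≃ ReflectionSubgroup cs where
  toFun Ψ := ⟨reflectionSubgroup Ψ, reflections Ψ, fun _ => isReflection_of_mem_reflections, rfl⟩
  invFun H := rootSubsystemOfSubgroup cs H.1
  left_inv := rootSubsystemOfSubgroup_reflectionSubgroup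
  right_inv := by
    rintro ⟨_, T, hT, rfl⟩
    exact Subtype.ext (reflectionSubgroup_rootSubsystemOfSubgroup_closure hT)

theorem smul_subset_simple_mul (i : B) (Ψ : cs.RootSubsystem) :
    (cs.simple i • Ψ).carrier ⊆ (RootSubsystem.simple i * Ψ).carrier := by
  rintro _ ⟨γ, hγ, rfl⟩
  rw [geomRep_simple, M.simpleReflection_apply]
  exact (RootSubsystem.simple i * Ψ).reflectionIn_mem _
    (RootSubsystem.left_subset_mul _ _ (Or.inl rfl)) _ (RootSubsystem.right_subset_mul _ _ hγ)

theorem simple_mul_smul (i : B) (Ψ : cs.RootSubsystem) :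
    RootSubsystem.simple i * cs.simple i • Ψ = RootSubsystem.simple i * Ψ := by
  have h := smul_subset_simple_mul i (cs.simple i • Ψ)
  rw [← mul_smul, cs.simple_mul_simple_self, one_smul] at h
  exact RootSubsystem.le_antisymm'
    (RootSubsystem.mul_subset (RootSubsystem.left_subset_mul _ _) (smul_subset_simple_mul i Ψ))
    (RootSubsystem.mul_subset (RootSubsystem.left_subset_mul _ _) h)

end CoxeterGroup

namespace MarinDatum

open CoxeterSystem CoxeterGroup

variable {k : Type*} [CommRing k] {B W : Type*} [Group W] {M : CoxeterMatrix B}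

theorem marinDatum_isAdmissible (cs : CoxeterSystem M W) (u : B → kˣ)
    (hu : ∀ (i j : B) (w : W), w * cs.simple i * w⁻¹ = cs.simple j → u i = u j) :
    (cs.marinDatum u hu).IsAdmissible := by
  intro i
  have ha : ((cs.marinDatum u hu).a i : MonoidAlgebra k cs.RootSubsystem) =
      1 + MonoidAlgebra.single (RootSubsystem.simple i) ((u i : k) - 1) := rfl
  have hρ : ∀ (Ψ : cs.RootSubsystem) (r : k), (cs.marinDatum u hu).ρ (cs.simple i)
      (MonoidAlgebra.single Ψ r) = MonoidAlgebra.single (cs.simple i • Ψ) r := fun Ψ r => by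
    simp [marinDatum, MarinDatum.ofMonoid]
  refine LinearMap.ext fun x => ?_
  rw [LinearMap.zero_apply, ha, sub_add_cancel_left]
  change -MonoidAlgebra.single (RootSubsystem.simple i) ((u i : k) - 1) *
    (x - (cs.marinDatum u hu).ρ (cs.simple i) x) = 0
  induction x using MonoidAlgebra.induction_linear with
  | zero => rw [map_zero, sub_zero, mul_zero]
  | add x y hx hy => rw [map_add, add_sub_add_comm, mul_add, hx, hy, add_zero]
  | single Ψ r =>
    rw [hρ, mul_sub, neg_mul, neg_mul, MonoidAlgebra.single_mul_single,
      MonoidAlgebra.single_mul_single, simple_mul_smul, sub_self]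

/-- The basis of the Marin algebra of the monoid of root subsystems given by the products of the
root subsystems, indexed by the corresponding reflection subgroups, with the `g_w`. -/
def rootSubsystemAlgBasis (cs : CoxeterSystem M W) (u : B → kˣ)
    (hu : ∀ (i j : B) (w : W), w * cs.simple i * w⁻¹ = cs.simple j → u i = u j) :
    Module.Basis (ReflectionSubgroup cs × W) k (cs.marinDatum u hu).Alg :=
  (algBasis (marinDatum_isAdmissible cs u hu) (MonoidAlgebra.basis cs.RootSubsystem k)).reindex
    ((rootSubsystemEquiv cs).prodCongr (Equiv.refl W))

end MarinDatum

end

open CoxeterGroup MarinDatum in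
theorem mainTheorem3_general {k : Type uk} [CommRing k] {B : Type uB} {W : Type uW}
    [Group W] {M : CoxeterMatrix B} (cs : CoxeterSystem M W) :
    (∀ ω : List B, cs.IsReduced ω →
      cs.artinSection (cs.wordProd ω) = (ω.map M.artinGenerator).prod) ∧
    (∀ {A : Type uA} [CommRing A] [Algebra k A] (D : MarinDatum k cs A),
      (Module.Finite k A → Finite W → Module.Finite k D.Alg) ∧
      (D.IsAdmissible →
        Function.Bijective (fun v : W →₀ A => v.sum fun w c => D.coeff c * D.g w) ∧
        (∀ {I : Type uI} (c : Module.Basis I k A),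
          ∃ b : Module.Basis (I × W) k D.Alg, ∀ i w, b (i, w) = D.coeff (c i) * D.g w) ∧
        (Module.Free k A → Module.Free k D.Alg ∧
          (Nontrivial k → Cardinal.lift.{uW} (Module.rank k D.Alg) =
            Cardinal.lift.{max uA uB} (Cardinal.mk W) *
              Cardinal.lift.{max uB uW} (Module.rank k A)) ∧
          (Module.Finite k A → Finite W → Nontrivial k →
            Module.finrank k D.Alg = Nat.card W * Module.finrank k A)))) ∧
    (∀ (u : B → kˣ)
      (hu : ∀ (i j : B) (w : W), w * cs.simple i * w⁻¹ = cs.simple j → u i = u j),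
      Module.Free k (cs.marinDatum u hu).Alg ∧
      (Nontrivial k → Cardinal.lift.{uW} (Module.rank k (cs.marinDatum u hu).Alg) =
        Cardinal.lift.{max uk uB} (Cardinal.mk (ReflectionSubgroup cs) * Cardinal.mk W)) ∧
      (Finite W → Module.Finite k (cs.marinDatum u hu).Alg ∧
        (Nontrivial k →
          Module.finrank k (cs.marinDatum u hu).Alg = cs.bell * Nat.card W))) := by
  refine ⟨fun ω hω => artinSection_wordProd hω,
    fun D => ⟨fun _ _ => finite_alg D, fun hD => ⟨hD.fromFree_bijective,
      fun c => ⟨algBasis hD c, algBasis_apply hD c⟩, fun _ => ⟨hD.free_alg,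
        fun _ => hD.rank_alg, fun _ _ _ => hD.finrank_alg⟩⟩⟩, fun u hu => ?_⟩
  let b := rootSubsystemAlgBasis cs u hu
  refine ⟨Module.Free.of_basis b, fun _ => ?_, fun _ => ⟨?_, fun _ => ?_⟩⟩
  · rw [← b.mk_eq_rank, Cardinal.mk_prod, Cardinal.lift_id, Cardinal.lift_id]
  · have : Finite (ReflectionSubgroup cs) := Subtype.finite
    exact Module.Finite.of_basis b
  · rw [Module.finrank_eq_nat_card_basis b, Nat.card_prod]
    rfl

theorem mainTheorem3 {k : Type uk} [CommRing k] {B : Type uB} {W : Type uW}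
    [Group W] {M : CoxeterMatrix B} (cs : CoxeterSystem M W) :
    -- the canonical section is given by every reduced expression
    (∀ ω : List B, cs.IsReduced ω →
      cs.artinSection (cs.wordProd ω) = (ω.map M.artinGenerator).prod) ∧
    -- the general rank formula
    (∀ {A : Type uA} [CommRing A] [Algebra k A] [Module.Free k A] [Module.Finite k A]
      (D : MarinDatum k cs A),
      (∀ i : B, (LinearMap.mulLeft k (1 - (D.a i : A)) : Module.End k A) *
        (1 - (D.ρ (cs.simple i)).toLinearMap) = 0) →
      Module.Free k D.Alg ∧
      (∀ {I : Type uI} (c : Module.Basis I k A),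
        ∃ b : Module.Basis (I × W) k D.Alg, ∀ i w, b (i, w) = D.coeff (c i) * D.g w) ∧
      (Nontrivial k → Cardinal.lift.{uW} (Module.rank k D.Alg) =
        Cardinal.lift.{max uA uB} (Cardinal.mk W) *
          Cardinal.lift.{max uB uW} (Module.rank k A)) ∧
      (Finite W → Module.Finite k D.Alg) ∧
      (Finite W → Nontrivial k →
        Module.finrank k D.Alg = Nat.card W * Module.finrank k A)) ∧
    -- Marin's rank formula
    (∀ (u : B → kˣ)
      (hu : ∀ (i j : B) (w : W), w * cs.simple i * w⁻¹ = cs.simple j → u i = u j),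
      Finite W →
      Module.Free k (cs.marinDatum u hu).Alg ∧
      Module.Finite k (cs.marinDatum u hu).Alg ∧
      (Nontrivial k →
        Module.finrank k (cs.marinDatum u hu).Alg = cs.bell * Nat.card W)) := by
  obtain ⟨hred, hrank, hbell⟩ := mainTheorem3_general (k := k) cs
  refine ⟨hred, fun D hD => ?_, fun u hu _ => ?_⟩
  · obtain ⟨-, hbasis, hfree⟩ := (hrank D).2 hD
    obtain ⟨hfree, hcard, hfinrank⟩ := hfree inferInstance
    exact ⟨hfree, hbasis, hcard, (hrank D).1 inferInstance, hfinrank inferInstance⟩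
  · exact ⟨(hbell u hu).1, (hbell u hu).2.2 inferInstance⟩
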